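/- All graphs are finite, undirected and loopless, and may have parallel edges; $\deg_G(v)$ is the number of edges of $G$ incident with $v$ (parallel edges counted separately), and graphs are considered up to isomorphism. **Edge-admissibility.** For a vertex $x$ of $G$ and $S\subseteq V(G)\setminus\{x\}$, let $\mathrm{supp}_{G,\infty}(x,S)$ be the minimum size of a set $A\subseteq E(G)$ such that every path of $G$ from $x$ to a vertex of $S$ contains an edge of $A$. The edge-admissibility $\delta_{\rm e}^{\infty}(G)$ is the minimum, over all linear orderings $v_1,\dots,v_n$ of $V(G)$, of $\max_{1\le i\le n}\mathrm{supp}_{G,\infty}(v_i,\{v_1,\dots,v_{i-1}\})$ (it is $0$ if $V(G)=\emptyset$). **Edge sums.** Let $G_1,G_2$ be graphs, let $x_i\in V(G_i)$ with $\deg_{G_1}(x_1)=\deg_{G_2}(x_2)=k$, and let $\sigma$ be a bijection from the set of edges of $G_1$ at $x_1$ to the set of edges of $G_2$ at $x_2$. The $k$-edge sum of $G_1$ and $G_2$ on $x_1,x_2$ with respect to $\sigma$ is obtained from the disjoint union of $G_1$ and $G_2$ by deleting $x_1$ and $x_2$ and adding, for each edge $e=x_1a$ of $G_1$ with $\sigma(e)=x_2b$,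 a new edge $ab$. A graph is a $(\le k)$-edge sum of $G_1$ and $G_2$ if it is their disjoint union or, for some $1\le k'\le k$, a $k'$-edge sum of them (for some $x_1,x_2,\sigma$). **Closure.** For a graph class $\mathcal G$, let $\mathcal G^{(\le k)}$ be the smallest class of graphs that contains $\mathcal G$ and contains every graph $G$ that is a $(\le k)$-edge sum of two graphs $G_1,G_2\in\mathcal G^{(\le k)}$ with $|V(G_1)|,|V(G_2)|<|V(G)|$. Let $\mathcal A_k$ be the class of graphs in which all vertices, except possibly one, have degree at most $k$. **Theorem.** Let $G$ be a graph. 1. For every integer $k\ge 0$, if $\delta_{\rm e}^{\infty}(G)\le k$, then $G\in\mathcal A_k^{(\le k)}$. 2. For every integer $k\ge 1$, if $G\in\mathcal A_k^{(\le k)}$, then $\delta_{\rm e}^{\infty}(G)\le 2k-1$. -/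

import Mathlib

universe u v u₁ v₁ u₂ v₂

namespace Graph

/-- The standing convention: a finite multigraph without loops (parallel edges are allowed). -/
structure IsFiniteLoopless {α : Type u} {β : Type v} (G : Graph α β) : Prop where
  finite_vertexSet : V(G).Finite
  finite_edgeSet : E(G).Finite
  loopless : G.Loopless

/-- The edge-degree `deg_G(x) = |E_G(x)|`: the number of edges incident with `x`, counted with
multiplicity. -/
noncomputable def edgeDegree {α : Type u} {β : Type v} (G : Graph α β) (x : α) : ℕ∞ :=
  (G.incidenceSet x).encard

/-! ### Paths -/

/-- Walks of a multigraph; a walk records the edges that it traverses. -/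
inductive Walk {α : Type u} {β : Type v} (G : Graph α β) : α → α → Type (max u v)
  | nil {x : α} (hx : x ∈ V(G)) : Walk G x x
  | cons {x y z : α} (e : β) (h : G.IsLink e x y) (w : Walk G y z) : Walk G x z

namespace Walk

variable {α : Type u} {β : Type v} {G : Graph α β}

/-- The vertices of a walk, in order. -/
def support {x y : α} : G.Walk x y → List α
  | nil _ => [x]
  | cons _ _ w => x :: w.support

/-- The edges of a walk, in order. -/
def edges {x y : α} : G.Walk x y → List β
  | nil _ => []
  | cons e _ w => e :: w.edges

/-- The length of a walk is its number of edges. -/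
def length {x y : α} (w : G.Walk x y) : ℕ := w.edges.length

/-- A path is a walk that does not repeat a vertex. -/
def IsPath {x y : α} (w : G.Walk x y) : Prop := w.support.Nodup

/-- An `s`-path is a path of length at most `s`, where `s` may be infinite. -/
def IsSPath (s : ℕ∞) {x y : α} (w : G.Walk x y) : Prop := w.IsPath ∧ (w.length : ℕ∞) ≤ s

end Walk

/-! ### `s`-edge-degeneracy and `∞`-edge-admissibility -/

section Degeneracy

variable {α : Type u} {β : Type v}

/-- `A` is an `(s, x, S)`-edge-separator: a set of edges of `G` that meets every `s`-path of `G`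
from `x` to a vertex of `S`. -/
def IsEdgeSeparator (G : Graph α β) (s : ℕ∞) (x : α) (S : Set α) (A : Set β) : Prop :=
  A ⊆ E(G) ∧ ∀ y ∈ S, ∀ w : G.Walk x y, w.IsSPath s → ∃ e ∈ w.edges, e ∈ A

/-- `supp_{G,s}(x, S)`: the minimum size of an `(s, x, S)`-edge-separator. -/
noncomputable def edgeSupp (G : Graph α β) (s : ℕ∞) (x : α) (S : Set α) : ℕ∞ :=
  ⨅ A : {A : Set β // G.IsEdgeSeparator s x S A}, A.1.encard

/-- A layout `⟨v₁, …, vₙ⟩` (linear ordering) of the vertices of `G`, where `n = |V(G)|`. -/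
abbrev Layout (G : Graph α β) : Type u := Fin V(G).ncard ≃ V(G)

/-- The `s`-edge-degeneracy of a layout: the maximum over `i` of the `s`-edge-support of `vᵢ`,
which is `supp_{G,s}(vᵢ, {vⱼ | j < i})`. -/
noncomputable def layoutEdgeDegeneracy (G : Graph α β) (s : ℕ∞) (L : G.Layout) : ℕ∞ :=
  ⨆ i, G.edgeSupp s (L i) {x | ∃ j < i, x = L j}

/-- The `s`-edge-degeneracy `δₑˢ(G)`: the minimum over all layouts of `G`. -/
noncomputable def edgeDegeneracy (G : Graph α β) (s : ℕ∞) : ℕ∞ :=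
  ⨅ L : G.Layout, G.layoutEdgeDegeneracy s L

/-- The `∞`-edge-admissibility (for short, edge-admissibility) `δₑ^∞(G)`. -/
noncomputable def edgeAdmissibility (G : Graph α β) : ℕ∞ := G.edgeDegeneracy ⊤

end Degeneracy

/-! ### Edge sums -/

/-- Isomorphisms of multigraphs. -/
structure Iso {α₁ : Type u₁} {β₁ : Type v₁} {α₂ : Type u₂} {β₂ : Type v₂}
    (G : Graph α₁ β₁) (H : Graph α₂ β₂) where
  vertexEquiv : V(G) ≃ V(H)
  edgeEquiv : E(G) ≃ E(H)
  isLink_iff : ∀ (e : E(G)) (x y : V(G)),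
    G.IsLink e x y ↔ H.IsLink (edgeEquiv e) (vertexEquiv x) (vertexEquiv y)

section Sums

variable {α₁ : Type u₁} {β₁ : Type v₁} {α₂ : Type u₂} {β₂ : Type v₂}

/-- Incidences of the disjoint union. -/
inductive DisjointUnionLink (G₁ : Graph α₁ β₁) (G₂ : Graph α₂ β₂) :
    β₁ ⊕ β₂ → α₁ ⊕ α₂ → α₁ ⊕ α₂ → Prop
  | left {e : β₁} {x y : α₁} (h : G₁.IsLink e x y) :
      DisjointUnionLink G₁ G₂ (.inl e) (.inl x) (.inl y)
  | right {e : β₂} {x y : α₂} (h : G₂.IsLink e x y) :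
      DisjointUnionLink G₁ G₂ (.inr e) (.inr x) (.inr y)

/-- The disjoint union of two multigraphs. -/
def disjointUnion (G₁ : Graph α₁ β₁) (G₂ : Graph α₂ β₂) : Graph (α₁ ⊕ α₂) (β₁ ⊕ β₂) where
  vertexSet := Sum.inl '' V(G₁) ∪ Sum.inr '' V(G₂)
  IsLink := DisjointUnionLink G₁ G₂
  isLink_symm _ _ := ⟨by
    rintro _ _ (h | h)
    · exact .left h.symm
    · exact .right h.symm⟩
  eq_or_eq_of_isLink_of_isLink := by
    rintro _ _ _ _ _ (h | h) (h' | h')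
    · simpa using h.left_eq_or_eq h'
    · simpa using h.left_eq_or_eq h'
  left_mem_of_isLink := by
    rintro _ _ _ (h | h)
    · exact .inl ⟨_, h.left_mem, rfl⟩
    · exact .inr ⟨_, h.left_mem, rfl⟩

/-- Incidences of the edge sum of `G₁` and `G₂` on `x₁` and `x₂` with respect to `σ`. The edges not
incident with `x₁`, `x₂` are kept. An edge `e` from `x₁` to `a` and the edge `σ e` from `x₂` to `b`
are lifted to one new edge from `a` to `b`, which is named `Sum.inl e`. (In loopless graphs the
conditions `a ≠ x₁` and `b ≠ x₂` of the last two constructors hold automatically.) -/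
inductive EdgeSumLink (G₁ : Graph α₁ β₁) (G₂ : Graph α₂ β₂) (x₁ : α₁) (x₂ : α₂)
    (σ : G₁.incidenceSet x₁ ≃ G₂.incidenceSet x₂) : β₁ ⊕ β₂ → α₁ ⊕ α₂ → α₁ ⊕ α₂ → Prop
  | left {e : β₁} {a b : α₁} (h : G₁.IsLink e a b) (ha : a ≠ x₁) (hb : b ≠ x₁) :
      EdgeSumLink G₁ G₂ x₁ x₂ σ (.inl e) (.inl a) (.inl b)
  | right {e : β₂} {a b : α₂} (h : G₂.IsLink e a b) (ha : a ≠ x₂) (hb : b ≠ x₂) :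
      EdgeSumLink G₁ G₂ x₁ x₂ σ (.inr e) (.inr a) (.inr b)
  | lift {e : β₁} {a : α₁} {b : α₂} (he : e ∈ G₁.incidenceSet x₁) (h₁ : G₁.IsLink e x₁ a)
      (h₂ : G₂.IsLink (σ ⟨e, he⟩) x₂ b) (ha : a ≠ x₁) (hb : b ≠ x₂) :
      EdgeSumLink G₁ G₂ x₁ x₂ σ (.inl e) (.inl a) (.inr b)
  | lift' {e : β₁} {a : α₁} {b : α₂} (he : e ∈ G₁.incidenceSet x₁) (h₁ : G₁.IsLink e x₁ a)
      (h₂ : G₂.IsLink (σ ⟨e, he⟩) x₂ b) (ha : a ≠ x₁) (hb : b ≠ x₂) :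
      EdgeSumLink G₁ G₂ x₁ x₂ σ (.inl e) (.inr b) (.inl a)

/-- The edge sum of `G₁` and `G₂` on `x₁` and `x₂` with respect to the bijection `σ`: take the
disjoint union, identify `x₁` with `x₂`, lift `e` with `σ e` for every edge `e` at `x₁`, and remove
the identified vertex. -/
def edgeSum (G₁ : Graph α₁ β₁) (G₂ : Graph α₂ β₂) (x₁ : α₁) (x₂ : α₂)
    (σ : G₁.incidenceSet x₁ ≃ G₂.incidenceSet x₂) : Graph (α₁ ⊕ α₂) (β₁ ⊕ β₂) where
  vertexSet := Sum.inl '' (V(G₁) \ {x₁}) ∪ Sum.inr '' (V(G₂) \ {x₂})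
  IsLink := EdgeSumLink G₁ G₂ x₁ x₂ σ
  isLink_symm _ _ := ⟨by
    rintro _ _ (⟨h, ha, hb⟩ | ⟨h, ha, hb⟩ | ⟨he, h₁, h₂, ha, hb⟩ | ⟨he, h₁, h₂, ha, hb⟩)
    · exact .left h.symm hb ha
    · exact .right h.symm hb ha
    · exact .lift' he h₁ h₂ ha hb
    · exact .lift he h₁ h₂ ha hb⟩
  eq_or_eq_of_isLink_of_isLink := by
    rintro e x y z w h h'
    rcases h with ⟨h, ha, hb⟩ | ⟨h, ha, hb⟩ | ⟨he, h₁, h₂, ha, hb⟩ | ⟨he, h₁, h₂, ha, hb⟩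
    · cases h' with
      | left h' _ _ => simpa using h.left_eq_or_eq h'
      | lift _ h₁ _ _ _ => exact absurd (h₁.left_eq_or_eq h) (by tauto)
      | lift' _ h₁ _ _ _ => exact absurd (h₁.left_eq_or_eq h) (by tauto)
    · cases h' with
      | right h' _ _ => simpa using h.left_eq_or_eq h'
    · cases h' with
      | left h' _ _ => exact absurd (h₁.left_eq_or_eq h') (by tauto)
      | lift _ h₁' h₂' _ _ => exact .inl (congrArg _ (h₁.right_unique h₁'))
      | lift' _ h₁' h₂' _ _ => exact .inr (congrArg _ (h₁.right_unique h₁'))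
    · cases h' with
      | left h' _ _ => exact absurd (h₁.left_eq_or_eq h') (by tauto)
      | lift _ h₁' h₂' _ _ => exact .inr (congrArg _ (h₂.right_unique h₂'))
      | lift' _ h₁' h₂' _ _ => exact .inl (congrArg _ (h₂.right_unique h₂'))
  left_mem_of_isLink := by
    rintro _ _ _ (⟨h, ha, hb⟩ | ⟨h, ha, hb⟩ | ⟨he, h₁, h₂, ha, hb⟩ | ⟨he, h₁, h₂, ha, hb⟩)
    · exact .inl ⟨_, ⟨h.left_mem, ha⟩, rfl⟩
    · exact .inr ⟨_, ⟨h.left_mem, ha⟩, rfl⟩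
    · exact .inl ⟨_, ⟨h₁.right_mem, ha⟩, rfl⟩
    · exact .inr ⟨_, ⟨h₂.right_mem, hb⟩, rfl⟩

/-- `G` is (up to isomorphism) a `k`-edge sum of `G₁` and `G₂`, for some choice of vertices of
edge-degree `k` and of a bijection between the edges at them. -/
def IsEdgeSum {α : Type u} {β : Type v} (k : ℕ) (G : Graph α β) (G₁ : Graph α₁ β₁)
    (G₂ : Graph α₂ β₂) : Prop :=
  ∃ x₁ ∈ V(G₁), ∃ x₂ ∈ V(G₂), G₁.edgeDegree x₁ = k ∧ G₂.edgeDegree x₂ = k ∧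
    ∃ σ : G₁.incidenceSet x₁ ≃ G₂.incidenceSet x₂, Nonempty (Iso G (edgeSum G₁ G₂ x₁ x₂ σ))

/-- `G` is (up to isomorphism) a `(≤ k)`-edge sum of `G₁` and `G₂`: their disjoint union, or a
`k'`-edge sum of them for some `1 ≤ k' ≤ k`. -/
def IsEdgeSumLE {α : Type u} {β : Type v} (k : ℕ) (G : Graph α β) (G₁ : Graph α₁ β₁)
    (G₂ : Graph α₂ β₂) : Prop :=
  Nonempty (Iso G (disjointUnion G₁ G₂)) ∨ ∃ k', 1 ≤ k' ∧ k' ≤ k ∧ IsEdgeSum k' G G₁ G₂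

end Sums

/-! ### The `(≤ k)`-sum closure -/

/-- The `(≤ k)`-sum closure `𝒢^(≤k)` of a graph class `𝒢`: the smallest class that contains `𝒢` and
contains every graph that is a `(≤ k)`-edge sum of two graphs of the closure, each with fewer
vertices than the sum. -/
inductive EdgeSumClosure (𝒢 : ∀ ⦃α : Type u⦄ ⦃β : Type v⦄, Graph α β → Prop) (k : ℕ) :
    ∀ ⦃α : Type u⦄ ⦃β : Type v⦄, Graph α β → Prop
  | base {α : Type u} {β : Type v} {G : Graph α β} (h : 𝒢 G) : EdgeSumClosure 𝒢 k G
  | sum {α α₁ α₂ : Type u} {β β₁ β₂ : Type v} {G : Graph α β} {G₁ : Graph α₁ β₁}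
      {G₂ : Graph α₂ β₂} (h₁ : EdgeSumClosure 𝒢 k G₁) (h₂ : EdgeSumClosure 𝒢 k G₂)
      (hlt₁ : V(G₁).encard < V(G).encard) (hlt₂ : V(G₂).encard < V(G).encard)
      (h : IsEdgeSumLE k G G₁ G₂) : EdgeSumClosure 𝒢 k G

/-- The class `𝒜ₖ` of almost `k`-bounded edge-degree graphs: the (finite loopless multi)graphs
whose vertices, except possibly one, have edge-degree at most `k`. -/
def AlmostBoundedEdgeDegree (k : ℕ) ⦃α : Type u⦄ ⦃β : Type v⦄ (G : Graph α β) : Prop :=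
  G.IsFiniteLoopless ∧ {x ∈ V(G) | (k : ℕ∞) < G.edgeDegree x}.Subsingleton

end Graph

/-! Everything is phrased through the cut function `Y ↦ cutSize Y`. By Menger-style reachability, a
layout has edge-degeneracy at most `k` exactly when every vertex `v` lies in a set `Y` of vertices
none of which precedes `v`, with at most `k` edges leaving `Y`. Such an ordering is an
`IsAdmissibleRank`.

From admissibility to the closure, induct on the number of vertices. If at least two vertices have
degree above `k`, let `s` be the last of them in the ranking. Among the sets containing `s` and no
vertex before `s`, choose `X` with the smallest cut, which is at most `k`. Then `s` is the only
vertex of large degree in `X`, so contracting the complement of `X` leaves an almost bounded graph.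
Contracting `X` to `s` preserves admissibility: minimality of `X`, submodularity and posimodularity
allow every witness set to be uncrossed with `X` (`IsAdmissibleRank.contract_collapse`). `G` is the
edge sum of the two contractions, or a disjoint union if the cut is empty.

From the closure to admissibility, the invariant is `HasRootedRanks`: any one vertex of cost at most
`k` can be made first. It survives sums: take a ranking of one summand and replace the summed vertex
by a ranking of the other summand rooted at its own summed vertex
(`HasRootedRanks.exists_of_contractions`). This yields the bound `k`, which is stronger than `2k -
1`. -/

namespace Graph

/-! ### Edge cuts -/

section Cut

variable {α : Type u} {β : Type v} {G : Graph α β}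

/-- The edge cut of `Y`: the edges between `Y` and its complement. -/
def cutSet (G : Graph α β) (Y : Set V(G)) : Set β :=
  {e | ∃ a b : V(G), G.IsLink e a b ∧ a ∈ Y ∧ b ∉ Y}

/-- The number of edges between `Y` and its complement. -/
noncomputable def cutSize (G : Graph α β) (Y : Set V(G)) : ℕ∞ := (G.cutSet Y).encard

theorem cutSet_subset_edgeSet (Y : Set V(G)) : G.cutSet Y ⊆ E(G) :=
  fun _ ⟨_, _, h, _⟩ ↦ h.edge_mem

theorem IsLink.mem_cutSet_iff {e : β} {a b : V(G)} (h : G.IsLink e a b) (Y : Set V(G)) :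
    e ∈ G.cutSet Y ↔ ¬(a ∈ Y ↔ b ∈ Y) := by
  constructor
  · rintro ⟨c, d, hcd, hc, hd⟩
    rcases h.eq_and_eq_or_eq_and_eq hcd with ⟨h₁, h₂⟩ | ⟨h₁, h₂⟩ <;>
      rw [Subtype.ext h₁, Subtype.ext h₂] <;> tauto
  · intro hn
    by_cases ha : a ∈ Y
    · exact ⟨a, b, h, ha, by tauto⟩
    · exact ⟨b, a, h.symm, by tauto, ha⟩

theorem exists_isLink_subtype {e : β} (he : e ∈ E(G)) : ∃ a b : V(G), G.IsLink e a b := by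
  obtain ⟨a, b, h⟩ := exists_isLink_of_mem_edgeSet he
  exact ⟨⟨a, h.left_mem⟩, ⟨b, h.right_mem⟩, h⟩

@[simp] theorem cutSize_univ : G.cutSize Set.univ = 0 := by
  simp [cutSize, cutSet]

@[simp] theorem cutSize_empty : G.cutSize ∅ = 0 := by
  simp [cutSize, cutSet]

theorem cutSet_compl (Y : Set V(G)) : G.cutSet Yᶜ = G.cutSet Y := by
  ext e
  by_cases he : e ∈ E(G)
  · obtain ⟨a, b, h⟩ := exists_isLink_subtype he
    rw [h.mem_cutSet_iff, h.mem_cutSet_iff, Set.mem_compl_iff, Set.mem_compl_iff, not_iff_not, not_iff_not]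
  · exact iff_of_false (fun h ↦ he (cutSet_subset_edgeSet _ h))
      (fun h ↦ he (cutSet_subset_edgeSet _ h))

theorem cutSize_compl (Y : Set V(G)) : G.cutSize Yᶜ = G.cutSize Y := by
  rw [cutSize, cutSet_compl, cutSize]

/-- Submodularity, checked edge by edge: an edge counted once on the left is counted on the right,
and one counted twice is counted twice. Counting through unions and intersections of edge sets
avoids any finiteness assumption. -/
theorem cutSize_union_add_cutSize_inter_le (A B : Set V(G)) :
    G.cutSize (A ∪ B) + G.cutSize (A ∩ B) ≤ G.cutSize A + G.cutSize B := by
  unfold cutSize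
  rw [← Set.encard_union_add_encard_inter (G.cutSet (A ∪ B)),
    ← Set.encard_union_add_encard_inter (G.cutSet A)]
  refine add_le_add (Set.encard_le_encard ?_) (Set.encard_le_encard ?_)
  · rintro e he
    obtain ⟨a, b, h⟩ := exists_isLink_subtype
      (he.elim (cutSet_subset_edgeSet _ ·) (cutSet_subset_edgeSet _ ·))
    simp only [Set.mem_union, h.mem_cutSet_iff, Set.mem_inter_iff] at he ⊢
    tauto
  · rintro e he
    obtain ⟨a, b, h⟩ := exists_isLink_subtype (cutSet_subset_edgeSet _ he.1)
    simp only [Set.mem_union, h.mem_cutSet_iff, Set.mem_inter_iff] at he ⊢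
    tauto

/-- Posimodularity: submodularity for `A` and `Bᶜ`, since a set and its complement have the same
cut. -/
theorem cutSize_sdiff_add_cutSize_sdiff_le (A B : Set V(G)) :
    G.cutSize (A \ B) + G.cutSize (B \ A) ≤ G.cutSize A + G.cutSize B := by
  have h := cutSize_union_add_cutSize_inter_le A Bᶜ
  rw [cutSize_compl B, ← cutSize_compl (A ∪ Bᶜ), add_comm] at h
  rwa [Set.compl_union, compl_compl, Set.inter_comm Aᶜ, ← Set.sdiff_eq, ← Set.sdiff_eq] at h

theorem cutSet_singleton_subset (x : V(G)) : G.cutSet {x} ⊆ G.incidenceSet x := by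
  rintro e ⟨a, b, h, rfl, -⟩
  exact ⟨b, h⟩

theorem cutSize_singleton_le (x : V(G)) : G.cutSize {x} ≤ G.edgeDegree x :=
  Set.encard_le_encard (cutSet_singleton_subset x)

theorem cutSet_singleton (hG : G.Loopless) (x : V(G)) : G.cutSet {x} = G.incidenceSet x := by
  refine (cutSet_singleton_subset x).antisymm fun e ⟨b, h⟩ ↦ ⟨x, ⟨b, h.right_mem⟩, h, rfl, ?_⟩
  intro hb
  exact hG.not_isLoopAt e x (congrArg Subtype.val (Set.mem_singleton_iff.1 hb) ▸ h)

theorem edgeDegree_eq_cutSize (hG : G.Loopless) (x : V(G)) :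
    G.edgeDegree x = G.cutSize {x} := by
  rw [cutSize, cutSet_singleton hG, edgeDegree]

/-- Contracting vertices, possibly renaming the edges, preserves the sizes of cuts. -/
theorem cutSize_preimage {α' : Type u₁} {β' : Type v₁} {H : Graph α' β'} (φ : V(G) → V(H))
    (η : E(H) → β) (hη : Function.Injective η)
    (hfwd : ∀ e (a b : V(G)), G.IsLink e a b → φ a ≠ φ b →
      ∃ e' : E(H), η e' = e ∧ H.IsLink e' (φ a) (φ b))
    (hbwd : ∀ (e' : E(H)) (a' b' : V(H)), H.IsLink e' a' b' → a' ≠ b' →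
      ∃ a b : V(G), G.IsLink (η e') a b ∧ φ a = a' ∧ φ b = b')
    (Y : Set V(H)) : G.cutSize (φ ⁻¹' Y) = H.cutSize Y := by
  have h : G.cutSet (φ ⁻¹' Y) = η '' (Subtype.val ⁻¹' H.cutSet Y) := by
    ext e
    constructor
    · rintro ⟨a, b, h, ha, hb⟩
      obtain ⟨e', rfl, h'⟩ := hfwd e a b h (fun h ↦ hb (show φ b ∈ Y from h ▸ ha))
      exact ⟨e', ⟨_, _, h', ha, hb⟩, rfl⟩
    · rintro ⟨e', ⟨a', b', h', ha, hb⟩, rfl⟩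
      obtain ⟨a, b, h, rfl, rfl⟩ := hbwd e' a' b' h' (fun h ↦ hb (h ▸ ha))
      exact ⟨a, b, h, ha, hb⟩
  rw [cutSize, h, hη.encard_image, cutSize, ← Subtype.val_injective.encard_image,
    Subtype.image_preimage_coe, Set.inter_eq_right.2 (cutSet_subset_edgeSet Y)]

theorem Iso.cutSize_preimage {α' : Type u₁} {β' : Type v₁} {H : Graph α' β'} (f : Iso G H)
    (Y : Set V(H)) : G.cutSize (f.vertexEquiv ⁻¹' Y) = H.cutSize Y := by
  refine Graph.cutSize_preimage f.vertexEquiv (fun e ↦ (f.edgeEquiv.symm e : β))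
    (Subtype.val_injective.comp f.edgeEquiv.symm.injective) ?_ ?_ Y
  · intro e a b h _
    refine ⟨f.edgeEquiv ⟨e, h.edge_mem⟩, by simp, (f.isLink_iff ⟨e, h.edge_mem⟩ a b).1 h⟩
  · intro e a b h _
    refine ⟨f.vertexEquiv.symm a, f.vertexEquiv.symm b, ?_, by simp, by simp⟩
    rw [f.isLink_iff]
    simpa using h

theorem Iso.loopless {α' : Type u₁} {β' : Type v₁} {H : Graph α' β'} (f : Iso G H)
    (hH : H.Loopless) : G.Loopless := by
  refine ⟨fun e x h ↦ ?_⟩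
  exact hH.not_isLoopAt _ _ ((f.isLink_iff ⟨e, h.edge_mem⟩ ⟨x, h.vertex_mem⟩ ⟨x, h.vertex_mem⟩).1 h)

end Cut

/-! ### Walks and cuts -/

namespace Walk

variable {α : Type u} {β : Type v} {G : Graph α β}

theorem exists_path_of_mem_support {x z : α} (p : G.Walk x z) (hp : p.IsPath) {y : α}
    (hy : y ∈ p.support) : ∃ q : G.Walk y z, q.IsPath ∧ q.edges ⊆ p.edges := by
  induction p with
  | nil hx =>
    obtain rfl : y = _ := by simpa [support] using hy
    exact ⟨nil hx, hp, fun _ h ↦ h⟩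
  | @cons x _ _ e h w ih =>
    by_cases hyx : y = x
    · subst hyx
      exact ⟨cons e h w, hp, fun _ h ↦ h⟩
    · obtain ⟨q, hq, hqe⟩ := ih (List.nodup_cons.1 hp).2
        ((List.mem_cons.1 hy).resolve_left hyx)
      exact ⟨q, hq, fun _ h ↦ List.mem_cons_of_mem _ (hqe h)⟩

theorem exists_path {x z : α} (w : G.Walk x z) : ∃ p : G.Walk x z, p.IsPath ∧ p.edges ⊆ w.edges := by
  induction w with
  | nil hx => exact ⟨nil hx, by simp [IsPath, support], fun _ h ↦ h⟩
  | @cons x y z e h w ih =>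
    obtain ⟨p, hp, hpe⟩ := ih
    by_cases hx : x ∈ p.support
    · obtain ⟨q, hq, hqe⟩ := exists_path_of_mem_support p hp hx
      exact ⟨q, hq, fun _ h ↦ List.mem_cons_of_mem _ (hpe (hqe h))⟩
    · exact ⟨cons e h p, List.nodup_cons.2 ⟨hx, hp⟩, List.cons_subset_cons _ hpe⟩

theorem exists_concat {x y z : α} {f : β} (w : G.Walk x y) (hf : G.IsLink f y z) :
    ∃ p : G.Walk x z, p.edges = w.edges ++ [f] := by
  induction w with
  | nil hx => exact ⟨cons f hf (nil hf.right_mem), rfl⟩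
  | cons e h w ih =>
    obtain ⟨p, hp⟩ := ih hf
    exact ⟨cons e h p, by simp [edges, hp]⟩

theorem exists_mem_cutSet {x y : α} (w : G.Walk x y) {Y : Set V(G)} (hx : x ∈ Subtype.val '' Y)
    (hy : y ∉ Subtype.val '' Y) : ∃ e ∈ w.edges, e ∈ G.cutSet Y := by
  induction w with
  | nil _ => exact absurd hx hy
  | @cons x z y e h w ih =>
    by_cases hz : z ∈ Subtype.val '' Y
    · obtain ⟨f, hf, hfY⟩ := ih hz hy
      exact ⟨f, List.mem_cons_of_mem _ hf, hfY⟩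
    · obtain ⟨a, ha, rfl⟩ := hx
      exact ⟨e, List.mem_cons_self, a, ⟨z, h.right_mem⟩, h, ha, fun hzY ↦ hz ⟨_, hzY, rfl⟩⟩

end Walk

/-! ### Admissible rankings -/

/-- `r` ranks the elements of `V` so that from every element `v`, the elements of smaller rank can
be cut off at cost at most `k`. -/
structure IsAdmissibleRank {V : Type u₁} {ι : Type u₂} [LinearOrder ι] (c : Set V → ℕ∞) (k : ℕ)
    (r : V → ι) : Prop where
  injective : Function.Injective r
  exists_cut : ∀ v, ∃ Y, v ∈ Y ∧ (∀ u ∈ Y, r v ≤ r u) ∧ c Y ≤ k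

/-! ### Layouts of small degeneracy are admissible rankings -/

section Layout

variable {α : Type u} {β : Type v} {G : Graph α β}

theorem edgeSupp_le_cutSize {x : V(G)} {S : Set α} {Y : Set V(G)} (hx : x ∈ Y)
    (hS : ∀ y ∈ Y, (y : α) ∉ S) : G.edgeSupp ⊤ x S ≤ G.cutSize Y := by
  refine iInf_le (fun A : {A // G.IsEdgeSeparator ⊤ x S A} ↦ A.1.encard)
    ⟨G.cutSet Y, cutSet_subset_edgeSet Y, fun y hy w _ ↦ w.exists_mem_cutSet ⟨x, hx, rfl⟩ ?_⟩
  rintro ⟨y, hyY, rfl⟩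
  exact hS y hyY hy

/-- Take a minimum separator `A` and let `Y` be the set of vertices reachable from `x` without using
`A`. Every edge leaving `Y` belongs to `A`. -/
theorem exists_cutSize_le_edgeSupp (x : V(G)) (S : Set α) (hx : (x : α) ∉ S) :
    ∃ Y : Set V(G), x ∈ Y ∧ (∀ y ∈ Y, (y : α) ∉ S) ∧ G.cutSize Y ≤ G.edgeSupp ⊤ x S := by
  have : Nonempty {A // G.IsEdgeSeparator ⊤ x S A} := by
    refine ⟨E(G), subset_rfl, fun y hy w _ ↦ ?_⟩
    cases w with
    | nil _ => exact absurd hy hx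
    | cons e h w => exact ⟨e, List.mem_cons_self, h.edge_mem⟩
  obtain ⟨⟨A, hAE, hA⟩, hA'⟩ := ENat.exists_eq_iInf
    (fun A : {A // G.IsEdgeSeparator ⊤ x S A} ↦ A.1.encard)
  refine ⟨{y | ∃ w : G.Walk x y, ∀ e ∈ w.edges, e ∉ A}, ⟨.nil x.2, by simp [Walk.edges]⟩, ?_, ?_⟩
  · rintro y ⟨w, hw⟩ hy
    obtain ⟨p, hp, hpw⟩ := w.exists_path
    obtain ⟨e, he, heA⟩ := hA y hy p ⟨hp, le_top⟩
    exact hw e (hpw he) heA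
  · rw [edgeSupp, ← hA']
    refine Set.encard_le_encard ?_
    rintro e ⟨a, b, h, ⟨w, hw⟩, hb⟩
    by_contra he
    obtain ⟨p, hp⟩ := w.exists_concat h
    refine hb ⟨p, fun f hf ↦ ?_⟩
    rw [hp, List.mem_append, List.mem_singleton] at hf
    rcases hf with hf | rfl
    exacts [hw f hf, he]

theorem edgeAdmissibility_le_of_isAdmissibleRank (hG : V(G).Finite) {k : ℕ} {ι : Type u₁}
    [LinearOrder ι] {r : V(G) → ι} (hr : IsAdmissibleRank G.cutSize k r) :
    G.edgeAdmissibility ≤ k := by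
  let _ : LinearOrder V(G) := LinearOrder.lift' r hr.injective
  have : Fintype V(G) := hG.fintype
  have hcard : Fintype.card V(G) = V(G).ncard := by
    rw [← Nat.card_eq_fintype_card, Nat.card_coe_set_eq]
  let L := monoEquivOfFin V(G) hcard
  refine (iInf_le _ L.toEquiv).trans (iSup_le fun i ↦ ?_)
  obtain ⟨Y, hvY, hY, hcY⟩ := hr.exists_cut (L i)
  refine (edgeSupp_le_cutSize hvY ?_).trans hcY
  rintro y hy ⟨j, hj, h⟩
  obtain rfl : y = L j := Subtype.ext h
  exact (L.lt_iff_lt.2 hj).not_ge (hY _ hy)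

theorem exists_isAdmissibleRank_of_edgeAdmissibility_le {k : ℕ}
    (h : G.edgeAdmissibility ≤ k) :
    ∃ r : V(G) → Fin V(G).ncard, IsAdmissibleRank G.cutSize k r := by
  have : Nonempty G.Layout := by
    by_contra hne
    rw [not_nonempty_iff] at hne
    -- Without layouts the infimum would be `⊤`, contradicting the finite bound.
    rw [edgeAdmissibility, edgeDegeneracy, iInf_of_empty, top_le_iff] at h
    exact ENat.natCast_ne_top k h
  obtain ⟨L, hL⟩ := ENat.exists_eq_iInf (G.layoutEdgeDegeneracy ⊤)
  refine ⟨L.symm, L.symm.injective, fun v ↦ ?_⟩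
  obtain ⟨Y, hvY, hY, hcY⟩ := exists_cutSize_le_edgeSupp v {x | ∃ j < L.symm v, x = L j} (by
    rintro ⟨j, hj, hv⟩
    rw [Subtype.ext hv, Equiv.symm_apply_apply] at hj
    exact hj.false)
  refine ⟨Y, hvY, fun u hu ↦ not_lt.1 fun hlt ↦ hY u hu ⟨_, hlt, by simp⟩, hcY.trans ?_⟩
  have h' := (le_iSup (fun i ↦ G.edgeSupp ⊤ (L i) {x | ∃ j < i, x = L j}) (L.symm v)).trans
    (hL.trans_le h)
  simpa using h'

end Layout

/-! ### Rankings with a prescribed first element -/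

/-- Every `x` with `c {x} ≤ k` is the first element of some admissible ranking, and there is
an admissible ranking. -/
def HasRootedRanks {V : Type u} (c : Set V → ℕ∞) (k : ℕ) : Prop :=
  ∀ S : Set V, S.Subsingleton → (∀ x ∈ S, c {x} ≤ k) →
    ∃ (ι : Type u) (_ : LinearOrder ι) (r : V → ι), IsAdmissibleRank c k r ∧
      ∀ x ∈ S, ∀ y, r x ≤ r y

namespace HasRootedRanks

/-- Substitute, for `x₁` in a ranking of `V₁`, a ranking of `V₂` that starts with `x₂`. -/
theorem exists_of_contractions {V V₁ V₂ : Type u} {k : ℕ} {c : Set V → ℕ∞} {c₁ : Set V₁ → ℕ∞}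
    {c₂ : Set V₂ → ℕ∞} {φ₁ : V → V₁} {φ₂ : V → V₂} {x₁ : V₁} {x₂ : V₂}
    (h₁ : ∀ Y, c (φ₁ ⁻¹' Y) = c₁ Y) (h₂ : ∀ Y, c (φ₂ ⁻¹' Y) = c₂ Y)
    (hφ : ∀ v, φ₁ v = x₁ ↔ φ₂ v ≠ x₂)
    (hinj₁ : ∀ u v, φ₁ u = φ₁ v → φ₁ v ≠ x₁ → u = v)
    (hinj₂ : ∀ u v, φ₂ u = φ₂ v → φ₂ v ≠ x₂ → u = v)
    (hx₂ : c₂ {x₂} ≤ k) (H₁ : HasRootedRanks c₁ k) (H₂ : HasRootedRanks c₂ k)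
    (S : Set V) (hS : S.Subsingleton) (hc : ∀ x ∈ S, c {x} ≤ k) (hSx : ∀ x ∈ S, φ₁ x ≠ x₁) :
    ∃ (ι : Type u) (_ : LinearOrder ι) (r : V → ι), IsAdmissibleRank c k r ∧
      ∀ x ∈ S, ∀ y, r x ≤ r y := by
  obtain ⟨ι₁, _, r₁, hr₁, hf₁⟩ := H₁ (φ₁ '' S) (hS.image _) (by
    rintro _ ⟨x, hx, rfl⟩
    rw [← h₁]
    convert hc x hx
    ext v
    exact ⟨fun h ↦ hinj₁ v x h (hSx x hx), fun h ↦ congrArg φ₁ h⟩)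
  obtain ⟨ι₂, _, r₂, hr₂, hf₂⟩ := H₂ {x₂} Set.subsingleton_singleton (by simpa using hx₂)
  -- In the lexicographic order the elements that `φ₁` sends to `x₁` form a block at the position of
  -- `x₁`, ordered inside by `r₂`.
  refine ⟨ι₁ ×ₗ ι₂, inferInstance, fun v ↦ toLex (r₁ (φ₁ v), r₂ (φ₂ v)), ⟨?_, ?_⟩, ?_⟩
  · intro u v h
    simp only [toLex_inj, Prod.mk.injEq] at h
    by_cases hv : φ₁ v = x₁
    · exact hinj₂ u v (hr₂.injective h.2) ((hφ v).1 hv)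
    · exact hinj₁ u v (hr₁.injective h.1) hv
  · intro v
    by_cases hv : φ₁ v = x₁
    · have hv₂ := (hφ v).1 hv
      obtain ⟨Y, hvY, hY, hcY⟩ := hr₂.exists_cut (φ₂ v)
      refine ⟨φ₂ ⁻¹' Y, hvY, fun u hu ↦ ?_, (h₂ Y).trans_le hcY⟩
      -- As `x₂` comes strictly before `φ₂ v` in `r₂`, the witness `Y` avoids `x₂`, so its preimage
      -- stays inside the block.
      have hu₁ : φ₁ u = x₁ := by
        rw [hφ]
        intro hu₂
        have h := hY _ hu
        rw [hu₂] at h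
        exact hv₂ (hr₂.injective (h.antisymm (hf₂ x₂ rfl _)))
      rw [Prod.Lex.toLex_le_toLex, hu₁, hv]
      exact .inr ⟨rfl, hY _ hu⟩
    · obtain ⟨Y, hvY, hY, hcY⟩ := hr₁.exists_cut (φ₁ v)
      refine ⟨φ₁ ⁻¹' Y, hvY, fun u hu ↦ ?_, (h₁ Y).trans_le hcY⟩
      rcases (hY _ hu).lt_or_eq with h | h
      · exact Prod.Lex.toLex_le_toLex.2 (.inl h)
      · rw [hinj₁ u v (hr₁.injective h.symm) hv]
  · intro x hx y
    rcases (hf₁ _ ⟨x, hx, rfl⟩ (φ₁ y)).lt_or_eq with h | h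
    · exact Prod.Lex.toLex_le_toLex.2 (.inl h)
    · rw [hinj₁ y x (hr₁.injective h.symm) (hSx x hx)]

/-- The construction is symmetric in the two sides; the outer ranking is taken on the side that
contains the root. -/
theorem of_contractions {V V₁ V₂ : Type u} {k : ℕ} {c : Set V → ℕ∞} {c₁ : Set V₁ → ℕ∞}
    {c₂ : Set V₂ → ℕ∞} {φ₁ : V → V₁} {φ₂ : V → V₂} {x₁ : V₁} {x₂ : V₂}
    (h₁ : ∀ Y, c (φ₁ ⁻¹' Y) = c₁ Y) (h₂ : ∀ Y, c (φ₂ ⁻¹' Y) = c₂ Y)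
    (hφ : ∀ v, φ₁ v = x₁ ↔ φ₂ v ≠ x₂)
    (hinj₁ : ∀ u v, φ₁ u = φ₁ v → φ₁ v ≠ x₁ → u = v)
    (hinj₂ : ∀ u v, φ₂ u = φ₂ v → φ₂ v ≠ x₂ → u = v)
    (hx₁ : c₁ {x₁} ≤ k) (hx₂ : c₂ {x₂} ≤ k)
    (H₁ : HasRootedRanks c₁ k) (H₂ : HasRootedRanks c₂ k) : HasRootedRanks c k := by
  intro S hS hc
  by_cases hSx : ∀ x ∈ S, φ₁ x ≠ x₁
  · exact exists_of_contractions h₁ h₂ hφ hinj₁ hinj₂ hx₂ H₁ H₂ S hS hc hSx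
  · push Not at hSx
    obtain ⟨x, hx, hx'⟩ := hSx
    refine exists_of_contractions h₂ h₁ (fun v ↦ ?_) hinj₂ hinj₁ hx₁ H₂ H₁ S hS hc ?_
    · have := hφ v
      tauto
    · intro y hy
      rw [hS hy hx]
      exact (hφ x).1 hx'

/-- Adding an isolated element. -/
theorem option {V : Type u} {k : ℕ} {c : Set V → ℕ∞} (h₀ : c ∅ = 0) (h₁ : c Set.univ = 0)
    (H : HasRootedRanks c k) : HasRootedRanks (fun Y : Set (Option V) ↦ c (some ⁻¹' Y)) k := by
  intro S hS hc
  -- The isolated element is free to separate, so it can go to either end: to the bottom if it is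
  -- the prescribed root, and to the top otherwise so as not to precede the root.
  by_cases hn : none ∈ S
  · obtain ⟨ι, _, r, hr, -⟩ := H ∅ Set.subsingleton_empty (by simp)
    let r' : Option V → WithBot ι := fun y ↦ y.elim ⊥ (fun v ↦ (r v : WithBot ι))
    have hmin : ∀ y, r' none ≤ r' y := fun y ↦ bot_le
    have hinj : Function.Injective r' := by
      rintro (_ | u) (_ | v) huv
      · rfl
      · cases huv
      · cases huv
      · rw [hr.injective (WithBot.coe_injective huv)]
    refine ⟨WithBot ι, inferInstance, r', ⟨hinj, ?_⟩, ?_⟩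
    · rintro (_ | v)
      · exact ⟨Set.univ, trivial, fun u _ ↦ hmin u, by simp [h₁]⟩
      · obtain ⟨Y, hvY, hY, hcY⟩ := hr.exists_cut v
        refine ⟨some '' Y, ⟨v, hvY, rfl⟩, ?_, ?_⟩
        · rintro _ ⟨u, hu, rfl⟩
          exact WithBot.coe_le_coe.2 (hY u hu)
        · rwa [Set.preimage_image_eq _ (Option.some_injective V)]
    · intro x hx y
      rw [hS hx hn]
      exact hmin y
  · obtain ⟨ι, _, r, hr, hf⟩ := H (some ⁻¹' S) (hS.preimage (Option.some_injective V)) (by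
      intro x hx
      convert hc _ hx
      ext y
      simp)
    let r' : Option V → WithTop ι := fun y ↦ y.elim ⊤ (fun v ↦ (r v : WithTop ι))
    have hmax : ∀ y, r' y ≤ r' none := fun y ↦ le_top
    have hinj : Function.Injective r' := by
      rintro (_ | u) (_ | v) huv
      · rfl
      · cases huv
      · cases huv
      · rw [hr.injective (WithTop.coe_injective huv)]
    refine ⟨WithTop ι, inferInstance, r', ⟨hinj, ?_⟩, ?_⟩
    · rintro (_ | v)
      · refine ⟨{none}, rfl, fun u hu ↦ by rw [Set.mem_singleton_iff.1 hu], ?_⟩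
        have : (some ⁻¹' {none} : Set V) = ∅ := by
          ext
          simp
        simp [this, h₀]
      · obtain ⟨Y, hvY, hY, hcY⟩ := hr.exists_cut v
        refine ⟨some '' Y, ⟨v, hvY, rfl⟩, ?_, ?_⟩
        · rintro _ ⟨u, hu, rfl⟩
          exact WithTop.coe_le_coe.2 (hY u hu)
        · rwa [Set.preimage_image_eq _ (Option.some_injective V)]
    · rintro (_ | x) hx (_ | y)
      · exact absurd hx hn
      · exact absurd hx hn
      · exact hmax _
      · exact WithTop.coe_le_coe.2 (hf x hx y)

/-- If all elements but one have small cost, rank that one early. -/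
theorem of_subsingleton {V : Type u} {k : ℕ} {c : Set V → ℕ∞} (h : c Set.univ = 0)
    (hcompl : ∀ Y, c Yᶜ = c Y) (hc : {x | (k : ℕ∞) < c {x}}.Subsingleton) :
    HasRootedRanks c k := by
  classical
  intro S hS hSc
  let _ : LinearOrder V := IsWellOrder.linearOrder WellOrderingRel
  -- Root first, then the expensive element, then the rest. Only the expensive element needs a
  -- witness other than its own singleton, and the complement of the root serves.
  let w : V → ℕ := fun v ↦ if v ∈ S then 0 else if (k : ℕ∞) < c {v} then 1 else 2
  refine ⟨ℕ ×ₗ V, inferInstance, fun v ↦ toLex (w v, v), ⟨?_, ?_⟩, ?_⟩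
  · intro u v huv
    simpa using congrArg (fun p ↦ (ofLex p).2) huv
  · intro v
    by_cases hv : c {v} ≤ k
    · exact ⟨{v}, rfl, fun u hu ↦ by rw [Set.mem_singleton_iff.1 hu], hv⟩
    · have hvS : v ∉ S := fun hvS ↦ hv (hSc v hvS)
      have hSk : c Sᶜ ≤ k := by
        rw [hcompl]
        rcases hS.eq_empty_or_singleton with rfl | ⟨x, rfl⟩
        · rw [← hcompl, Set.compl_empty, h]
          exact zero_le
        · exact hSc x rfl
      refine ⟨Sᶜ, hvS, fun u hu ↦ ?_, hSk⟩
      rw [not_le] at hv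
      by_cases huk : (k : ℕ∞) < c {u}
      · rw [hc huk hv]
      · refine Prod.Lex.toLex_le_toLex.2 (.inl ?_)
        simp [w, hvS, hv, huk, show u ∉ S from hu]
  · intro x hx y
    by_cases hy : y ∈ S
    · rw [hS hx hy]
    · refine Prod.Lex.toLex_le_toLex.2 (.inl ?_)
      simp only [w, hx, hy, if_true, if_false]
      split_ifs <;> simp

end HasRootedRanks

/-! ### Rankings of sums -/

section Sums

variable {α₁ : Type u} {β₁ : Type v} {α₂ : Type u} {β₂ : Type v}
  {G₁ : Graph α₁ β₁} {G₂ : Graph α₂ β₂}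

theorem loopless_disjointUnion (h₁ : G₁.Loopless) (h₂ : G₂.Loopless) :
    (disjointUnion G₁ G₂).Loopless := by
  refine ⟨fun e x h ↦ ?_⟩
  change DisjointUnionLink G₁ G₂ e x x at h
  cases h with
  | left h => exact h₁.not_isLoopAt _ _ h
  | right h => exact h₂.not_isLoopAt _ _ h

theorem loopless_edgeSum {x₁ : α₁} {x₂ : α₂} (σ : G₁.incidenceSet x₁ ≃ G₂.incidenceSet x₂)
    (h₁ : G₁.Loopless) (h₂ : G₂.Loopless) : (edgeSum G₁ G₂ x₁ x₂ σ).Loopless := by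
  refine ⟨fun e x h ↦ ?_⟩
  change EdgeSumLink G₁ G₂ x₁ x₂ σ e x x at h
  cases h with
  | left h => exact h₁.not_isLoopAt _ _ h
  | right h => exact h₂.not_isLoopAt _ _ h

/-- The left-hand side of a disjoint union. -/
def disjointUnionLeft (G₁ : Graph α₁ β₁) (G₂ : Graph α₂ β₂) :
    V(disjointUnion G₁ G₂) → Option V(G₁)
  | ⟨.inl a, h⟩ => some ⟨a, by simpa [disjointUnion] using h⟩
  | ⟨.inr _, _⟩ => none

/-- The right-hand side of a disjoint union. -/
def disjointUnionRight (G₁ : Graph α₁ β₁) (G₂ : Graph α₂ β₂) :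
    V(disjointUnion G₁ G₂) → Option V(G₂)
  | ⟨.inl _, _⟩ => none
  | ⟨.inr b, h⟩ => some ⟨b, by simpa [disjointUnion] using h⟩

theorem cutSize_preimage_disjointUnionLeft (Y : Set (Option V(G₁))) :
    (disjointUnion G₁ G₂).cutSize (disjointUnionLeft G₁ G₂ ⁻¹' Y) = G₁.cutSize (some ⁻¹' Y) := by
  rw [cutSize, cutSize, ← (Sum.inl_injective (β := β₂)).encard_image (G₁.cutSet _)]
  apply congrArg Set.encard
  ext e
  constructor
  · rintro ⟨⟨a, ha⟩, ⟨b, hb⟩, h, haY, hbY⟩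
    change DisjointUnionLink G₁ G₂ e a b at h
    cases h with
    | left h => exact ⟨_, ⟨_, _, h, haY, hbY⟩, rfl⟩
    | right h => exact absurd haY hbY
  · rintro ⟨e, ⟨a, b, h, haY, hbY⟩, rfl⟩
    exact ⟨⟨.inl a, .inl ⟨a, a.2, rfl⟩⟩, ⟨.inl b, .inl ⟨b, b.2, rfl⟩⟩,
      DisjointUnionLink.left h, haY, hbY⟩

theorem cutSize_preimage_disjointUnionRight (Y : Set (Option V(G₂))) :
    (disjointUnion G₁ G₂).cutSize (disjointUnionRight G₁ G₂ ⁻¹' Y) =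
      G₂.cutSize (some ⁻¹' Y) := by
  rw [cutSize, cutSize, ← (Sum.inr_injective (α := β₁)).encard_image (G₂.cutSet _)]
  apply congrArg Set.encard
  ext e
  constructor
  · rintro ⟨⟨a, ha⟩, ⟨b, hb⟩, h, haY, hbY⟩
    change DisjointUnionLink G₁ G₂ e a b at h
    cases h with
    | left h => exact absurd haY hbY
    | right h => exact ⟨_, ⟨_, _, h, haY, hbY⟩, rfl⟩
  · rintro ⟨e, ⟨a, b, h, haY, hbY⟩, rfl⟩
    exact ⟨⟨.inr a, .inr ⟨a, a.2, rfl⟩⟩, ⟨.inr b, .inr ⟨b, b.2, rfl⟩⟩,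
      DisjointUnionLink.right h, haY, hbY⟩

/-- A disjoint union behaves like an edge sum on two added isolated vertices: each side, seen from
the other, contracts to `none`. -/
theorem hasRootedRanks_disjointUnion {k : ℕ} (H₁ : HasRootedRanks G₁.cutSize k)
    (H₂ : HasRootedRanks G₂.cutSize k) : HasRootedRanks (disjointUnion G₁ G₂).cutSize k := by
  refine HasRootedRanks.of_contractions (x₁ := none) (x₂ := none)
    cutSize_preimage_disjointUnionLeft cutSize_preimage_disjointUnionRight ?_ ?_ ?_ ?_ ?_
    (H₁.option cutSize_empty cutSize_univ) (H₂.option cutSize_empty cutSize_univ)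
  · rintro ⟨a | b, h⟩ <;> simp [disjointUnionLeft, disjointUnionRight]
  · rintro ⟨a | b, h⟩ ⟨c | d, h'⟩ <;> simp [disjointUnionLeft]
  · rintro ⟨a | b, h⟩ ⟨c | d, h'⟩ <;> simp [disjointUnionRight]
  all_goals
    rw [show (some ⁻¹' {none} : Set _) = ∅ by ext; simp, cutSize_empty]
    exact zero_le

variable {x₁ : α₁} {x₂ : α₂} {σ : G₁.incidenceSet x₁ ≃ G₂.incidenceSet x₂}

/-- The contraction of the right-hand side of an edge sum. -/
def edgeSumLeft (hx₁ : x₁ ∈ V(G₁)) (σ : G₁.incidenceSet x₁ ≃ G₂.incidenceSet x₂) :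
    V(edgeSum G₁ G₂ x₁ x₂ σ) → V(G₁)
  | ⟨.inl a, h⟩ => ⟨a, by simp [edgeSum] at h; exact h.1⟩
  | ⟨.inr _, _⟩ => ⟨x₁, hx₁⟩

/-- The contraction of the left-hand side of an edge sum. -/
def edgeSumRight (hx₂ : x₂ ∈ V(G₂)) (σ : G₁.incidenceSet x₁ ≃ G₂.incidenceSet x₂) :
    V(edgeSum G₁ G₂ x₁ x₂ σ) → V(G₂)
  | ⟨.inl _, _⟩ => ⟨x₂, hx₂⟩
  | ⟨.inr b, h⟩ => ⟨b, by simp [edgeSum] at h; exact h.1⟩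

theorem inl_mem_edgeSum {a : α₁} (ha : a ∈ V(G₁)) (hax : a ≠ x₁) :
    Sum.inl a ∈ V(edgeSum G₁ G₂ x₁ x₂ σ) := .inl ⟨a, ⟨ha, hax⟩, rfl⟩

theorem inr_mem_edgeSum {b : α₂} (hb : b ∈ V(G₂)) (hbx : b ≠ x₂) :
    Sum.inr b ∈ V(edgeSum G₁ G₂ x₁ x₂ σ) := .inr ⟨b, ⟨hb, hbx⟩, rfl⟩

/-- Contracting the right-hand side of the sum recovers the cuts of `G₁`. Looplessness of `G₂`
guarantees that the partner of each edge at `x₁` has an end other than `x₂`, so that the edge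
survives as a lifted one. -/
theorem cutSize_preimage_edgeSumLeft (h₂ : G₂.Loopless) (hx₁ : x₁ ∈ V(G₁)) (Y : Set V(G₁)) :
    (edgeSum G₁ G₂ x₁ x₂ σ).cutSize (edgeSumLeft hx₁ σ ⁻¹' Y) = G₁.cutSize Y := by
  refine cutSize_preimage _ (fun e ↦ .inl e.1) (Sum.inl_injective.comp Subtype.val_injective)
    ?_ ?_ Y
  · rintro e ⟨a, ha⟩ ⟨b, hb⟩ h hab
    change EdgeSumLink G₁ G₂ x₁ x₂ σ e a b at h
    cases h with
    | left h _ _ => exact ⟨⟨_, h.edge_mem⟩, rfl, h⟩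
    | right h _ _ => exact absurd rfl hab
    | lift he h _ _ _ => exact ⟨⟨_, h.edge_mem⟩, rfl, h.symm⟩
    | lift' he h _ _ _ => exact ⟨⟨_, h.edge_mem⟩, rfl, h⟩
  · rintro ⟨e, _⟩ ⟨a, ha⟩ ⟨b, hb⟩ h hab
    replace hab : a ≠ b := fun h ↦ hab (Subtype.ext h)
    change G₁.IsLink e a b at h
    by_cases hax : a = x₁
    · subst hax
      obtain ⟨d, hd⟩ := (σ ⟨e, b, h⟩).2
      have hdx : d ≠ x₂ := fun hdx ↦ h₂.not_isLoopAt _ x₂ (hdx ▸ hd)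
      exact ⟨⟨.inr d, inr_mem_edgeSum hd.right_mem hdx⟩, ⟨.inl b, inl_mem_edgeSum hb hab.symm⟩,
        EdgeSumLink.lift' _ h hd hab.symm hdx, rfl, rfl⟩
    by_cases hbx : b = x₁
    · subst hbx
      obtain ⟨d, hd⟩ := (σ ⟨e, a, h.symm⟩).2
      have hdx : d ≠ x₂ := fun hdx ↦ h₂.not_isLoopAt _ x₂ (hdx ▸ hd)
      exact ⟨⟨.inl a, inl_mem_edgeSum ha hab⟩, ⟨.inr d, inr_mem_edgeSum hd.right_mem hdx⟩,
        EdgeSumLink.lift _ h.symm hd hab hdx, rfl, rfl⟩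
    · exact ⟨⟨.inl a, inl_mem_edgeSum ha hax⟩, ⟨.inl b, inl_mem_edgeSum hb hbx⟩,
        EdgeSumLink.left h hax hbx, rfl, rfl⟩

open Classical in
/-- The edge of an edge sum that comes from an edge of the right-hand side. -/
noncomputable def edgeSumRightEdge (σ : G₁.incidenceSet x₁ ≃ G₂.incidenceSet x₂) (e : β₂) :
    β₁ ⊕ β₂ :=
  if h : e ∈ G₂.incidenceSet x₂ then .inl (σ.symm ⟨e, h⟩) else .inr e

theorem edgeSumRightEdge_apply (e : G₁.incidenceSet x₁) :
    edgeSumRightEdge σ (σ e) = .inl e.1 := by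
  rw [edgeSumRightEdge, dif_pos (σ e).2, Subtype.coe_eta, Equiv.symm_apply_apply]

theorem edgeSumRightEdge_injective : Function.Injective (edgeSumRightEdge σ) := by
  intro e f h
  unfold edgeSumRightEdge at h
  split_ifs at h with he hf hf
  · simpa using σ.symm.injective (Subtype.ext (Sum.inl_injective h))
  · exact Sum.inr_injective h

theorem cutSize_preimage_edgeSumRight (h₁ : G₁.Loopless) (hx₂ : x₂ ∈ V(G₂)) (Y : Set V(G₂)) :
    (edgeSum G₁ G₂ x₁ x₂ σ).cutSize (edgeSumRight hx₂ σ ⁻¹' Y) = G₂.cutSize Y := by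
  refine cutSize_preimage _ (fun e ↦ edgeSumRightEdge σ e.1)
    (edgeSumRightEdge_injective.comp Subtype.val_injective) ?_ ?_ Y
  · rintro e ⟨a, ha⟩ ⟨b, hb⟩ h hab
    change EdgeSumLink G₁ G₂ x₁ x₂ σ e a b at h
    cases h with
    | left h _ _ => exact absurd rfl hab
    | right h hax hbx =>
      refine ⟨⟨_, h.edge_mem⟩, dif_neg ?_, h⟩
      intro hi
      rcases Inc.eq_or_eq_of_isLink hi h with h | h
      exacts [hax h.symm, hbx h.symm]
    | lift he _ h _ _ => exact ⟨⟨_, h.edge_mem⟩, edgeSumRightEdge_apply _, h⟩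
    | lift' he _ h _ _ => exact ⟨⟨_, h.edge_mem⟩, edgeSumRightEdge_apply _, h.symm⟩
  · rintro ⟨e, _⟩ ⟨a, ha⟩ ⟨b, hb⟩ h hab
    replace hab : a ≠ b := fun h ↦ hab (Subtype.ext h)
    change G₂.IsLink e a b at h
    by_cases hi : e ∈ G₂.incidenceSet x₂
    · obtain ⟨f, hf⟩ := σ.surjective ⟨e, hi⟩
      obtain rfl : (σ f : β₂) = e := congrArg Subtype.val hf
      simp only [edgeSumRightEdge_apply]
      obtain ⟨d, hd⟩ := f.2
      have hdx : d ≠ x₁ := fun hdx ↦ h₁.not_isLoopAt _ x₁ (hdx ▸ hd)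
      rcases Inc.eq_or_eq_of_isLink hi h with rfl | rfl
      · exact ⟨⟨.inl d, inl_mem_edgeSum hd.right_mem hdx⟩,
          ⟨.inr b, inr_mem_edgeSum hb hab.symm⟩, EdgeSumLink.lift f.2 hd h hdx hab.symm, rfl, rfl⟩
      · exact ⟨⟨.inr a, inr_mem_edgeSum ha hab⟩, ⟨.inl d, inl_mem_edgeSum hd.right_mem hdx⟩,
          EdgeSumLink.lift' f.2 hd h.symm hdx hab, rfl, rfl⟩
    · have hax : a ≠ x₂ := fun hax ↦ hi (hax ▸ h.inc_left)
      have hbx : b ≠ x₂ := fun hbx ↦ hi (hbx ▸ h.inc_right)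
      refine ⟨⟨.inr a, inr_mem_edgeSum ha hax⟩, ⟨.inr b, inr_mem_edgeSum hb hbx⟩, ?_, rfl, rfl⟩
      simp only [edgeSumRightEdge, dif_neg hi]
      exact EdgeSumLink.right h hax hbx

theorem hasRootedRanks_edgeSum {k : ℕ} (h₁ : G₁.Loopless) (h₂ : G₂.Loopless)
    (hx₁ : x₁ ∈ V(G₁)) (hx₂ : x₂ ∈ V(G₂)) (hd₁ : G₁.edgeDegree x₁ ≤ k)
    (hd₂ : G₂.edgeDegree x₂ ≤ k) (H₁ : HasRootedRanks G₁.cutSize k)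
    (H₂ : HasRootedRanks G₂.cutSize k) :
    HasRootedRanks (edgeSum G₁ G₂ x₁ x₂ σ).cutSize k := by
  refine HasRootedRanks.of_contractions (x₁ := ⟨x₁, hx₁⟩) (x₂ := ⟨x₂, hx₂⟩)
    (cutSize_preimage_edgeSumLeft h₂ hx₁) (cutSize_preimage_edgeSumRight h₁ hx₂) ?_ ?_ ?_
    ((cutSize_singleton_le _).trans hd₁) ((cutSize_singleton_le _).trans hd₂) H₁ H₂
  · rintro ⟨a | b, h⟩ <;> simp [edgeSum] at h <;> simp [edgeSumLeft, edgeSumRight, h.2]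
  · rintro ⟨a | b, h⟩ ⟨c | d, h'⟩ <;> simp [edgeSum] at h h' <;> simp +contextual [edgeSumLeft, h, h']
  · rintro ⟨a | b, h⟩ ⟨c | d, h'⟩ <;> simp [edgeSum] at h h' <;> simp +contextual [edgeSumRight, h, h']

end Sums

/-! ### From the closure to admissibility -/

theorem hasRootedRanks_of_iso {α α' : Type u} {β β' : Type v} {G : Graph α β} {H : Graph α' β'}
    (f : Iso G H) {k : ℕ} (hH : HasRootedRanks H.cutSize k) : HasRootedRanks G.cutSize k := by
  intro S hS hc
  obtain ⟨ι, _, r, hr, hf⟩ := hH (f.vertexEquiv '' S) (hS.image _) (by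
    rintro _ ⟨x, hx, rfl⟩
    rw [← f.cutSize_preimage]
    convert hc x hx
    ext
    simp)
  refine ⟨ι, inferInstance, r ∘ f.vertexEquiv, ⟨hr.injective.comp f.vertexEquiv.injective, ?_⟩,
    fun x hx y ↦ hf _ ⟨x, hx, rfl⟩ _⟩
  intro v
  obtain ⟨Y, hvY, hY, hcY⟩ := hr.exists_cut (f.vertexEquiv v)
  exact ⟨_, hvY, fun u hu ↦ hY _ hu, (f.cutSize_preimage Y).trans_le hcY⟩

/-- Looplessness is carried through the induction because the comparison of cuts in an edge sum
needs it for both summands. -/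
theorem EdgeSumClosure.loopless_and_hasRootedRanks {α : Type u} {β : Type v} {G : Graph α β}
    {k : ℕ} (h : EdgeSumClosure (AlmostBoundedEdgeDegree k) k G) :
    G.Loopless ∧ HasRootedRanks G.cutSize k := by
  induction h with
  | base h =>
    refine ⟨h.1.loopless, .of_subsingleton cutSize_univ cutSize_compl fun x hx y hy ↦ ?_⟩
    exact Subtype.ext (h.2 ⟨x.2, hx.trans_le (cutSize_singleton_le x)⟩
      ⟨y.2, hy.trans_le (cutSize_singleton_le y)⟩)
  | sum _ _ _ _ h ih₁ ih₂ =>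
    rcases h with ⟨⟨f⟩⟩ | ⟨k', -, hk', x₁, hx₁, x₂, hx₂, hd₁, hd₂, σ, ⟨f⟩⟩
    · exact ⟨f.loopless (loopless_disjointUnion ih₁.1 ih₂.1),
        hasRootedRanks_of_iso f (hasRootedRanks_disjointUnion ih₁.2 ih₂.2)⟩
    · have hk : (k' : ℕ∞) ≤ _ := Nat.cast_le.2 hk'
      exact ⟨f.loopless (loopless_edgeSum σ ih₁.1 ih₂.1),
        hasRootedRanks_of_iso f (hasRootedRanks_edgeSum ih₁.1 ih₂.1 hx₁ hx₂ (hd₁.trans_le hk)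
          (hd₂.trans_le hk) ih₁.2 ih₂.2)⟩

theorem EdgeSumClosure.edgeAdmissibility_le {α : Type u} {β : Type v} {G : Graph α β}
    (hG : V(G).Finite) {k : ℕ} (h : EdgeSumClosure (AlmostBoundedEdgeDegree k) k G) :
    G.edgeAdmissibility ≤ k := by
  obtain ⟨ι, _, r, hr, -⟩ :=
    h.loopless_and_hasRootedRanks.2 ∅ Set.subsingleton_empty (by simp)
  exact edgeAdmissibility_le_of_isAdmissibleRank hG hr

/-! ### Decomposing along an edge cut -/

section Contract

variable {α : Type u} {β : Type v} {G : Graph α β}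

/-- Identify vertices along `q` and delete the loops that arise. -/
def contract (G : Graph α β) (q : α → α) : Graph α β where
  vertexSet := q '' V(G)
  IsLink e a b := a ≠ b ∧ ∃ a' b', G.IsLink e a' b' ∧ q a' = a ∧ q b' = b
  isLink_symm _ _ := ⟨by
    rintro _ _ ⟨h, a, b, hab, rfl, rfl⟩
    exact ⟨h.symm, b, a, hab.symm, rfl, rfl⟩⟩
  eq_or_eq_of_isLink_of_isLink := by
    rintro _ _ _ _ _ ⟨_, a, b, hab, rfl, rfl⟩ ⟨_, c, d, hcd, rfl, rfl⟩
    exact (hab.left_eq_or_eq hcd).imp (congrArg q) (congrArg q)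
  left_mem_of_isLink := by
    rintro _ _ _ ⟨_, a, b, hab, rfl, rfl⟩
    exact ⟨a, hab.left_mem, rfl⟩

/-- The map from the vertices of a graph to those of a contraction. -/
def contractMap (G : Graph α β) (q : α → α) (a : V(G)) : V(G.contract q) := ⟨q a, a, a.2, rfl⟩

theorem cutSize_preimage_contractMap (q : α → α) (Y : Set V(G.contract q)) :
    G.cutSize (G.contractMap q ⁻¹' Y) = (G.contract q).cutSize Y := by
  refine cutSize_preimage _ Subtype.val Subtype.val_injective ?_ ?_ Y
  · intro e a b h hab
    have h' : (G.contract q).IsLink e (q a) (q b) :=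
      ⟨fun h ↦ hab (Subtype.ext h), a, b, h, rfl, rfl⟩
    exact ⟨⟨e, h'.edge_mem⟩, rfl, h'⟩
  · rintro e a b ⟨_, a', b', h, ha, hb⟩ _
    exact ⟨⟨a', h.left_mem⟩, ⟨b', h.right_mem⟩, h, Subtype.ext ha, Subtype.ext hb⟩

theorem IsFiniteLoopless.contract (hG : G.IsFiniteLoopless) (q : α → α) :
    (G.contract q).IsFiniteLoopless where
  finite_vertexSet := hG.finite_vertexSet.image q
  finite_edgeSet := hG.finite_edgeSet.subset fun _ ⟨_, _, _, _, _, h, _⟩ ↦ h.edge_mem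
  loopless := ⟨fun _ _ h ↦ h.1 rfl⟩

theorem IsFiniteLoopless.anti {H : Graph α β} (hG : G.IsFiniteLoopless) (h : H ≤ G) :
    H.IsFiniteLoopless where
  finite_vertexSet := hG.finite_vertexSet.subset h.vertexSet_mono
  finite_edgeSet := hG.finite_edgeSet.subset h.edgeSet_mono
  loopless := have := hG.loopless; Loopless.anti h

theorem nonempty_iso_of_injective {α' : Type u₁} {β' : Type v₁} {H : Graph α' β'} {f : α → α'}
    {g : β → β'} (hf : Function.Injective f) (hg : Function.Injective g) (hV : V(H) = f '' V(G))
    (h : ∀ e x y, H.IsLink e x y ↔ ∃ e' x' y', G.IsLink e' x' y' ∧ g e' = e ∧ f x' = x ∧ f y' = y) :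
    Nonempty (Iso G H) := by
  have hE : E(H) = g '' E(G) := by
    ext e
    constructor
    · intro he
      obtain ⟨x, y, hxy⟩ := exists_isLink_of_mem_edgeSet he
      obtain ⟨e', x', y', h', rfl, -⟩ := (h _ _ _).1 hxy
      exact ⟨e', h'.edge_mem, rfl⟩
    · rintro ⟨e', he, rfl⟩
      obtain ⟨x, y, hxy⟩ := exists_isLink_of_mem_edgeSet he
      exact ((h _ _ _).2 ⟨e', x, y, hxy, rfl, rfl, rfl⟩).edge_mem
  refine ⟨(Equiv.Set.image f _ hf).trans (Equiv.setCongr hV.symm),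
    (Equiv.Set.image g _ hg).trans (Equiv.setCongr hE.symm), fun e x y ↦ ?_⟩
  change _ ↔ H.IsLink (g e) (f x) (f y)
  rw [h]
  constructor
  · exact fun h ↦ ⟨_, _, _, h, rfl, rfl, rfl⟩
  · rintro ⟨e', x', y', h, he, hx, hy⟩
    rwa [hg he, hf hx, hf hy] at h

open Classical in
/-- Sort the elements of a type into those inside and those outside a set. -/
noncomputable def sideMap {γ : Type*} (A : Set γ) (a : γ) : γ ⊕ γ :=
  if a ∈ A then .inl a else .inr a

theorem sideMap_of_mem {γ : Type*} {A : Set γ} {a : γ} (h : a ∈ A) : sideMap A a = .inl a :=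
  if_pos h

theorem sideMap_of_notMem {γ : Type*} {A : Set γ} {a : γ} (h : a ∉ A) : sideMap A a = .inr a :=
  if_neg h

theorem sideMap_injective {γ : Type*} (A : Set γ) : Function.Injective (sideMap A) := by
  intro a b h
  by_cases ha : a ∈ A <;> by_cases hb : b ∈ A <;> simp_all [sideMap]

theorem exists_mem_inc_iff {A : Set α} {e : β} {a b : α} (h : G.IsLink e a b) :
    e ∈ {e | ∃ a ∈ A, G.Inc e a} ↔ a ∈ A ∨ b ∈ A := by
  constructor
  · rintro ⟨c, hc, hi⟩
    rcases hi.eq_or_eq_of_isLink h with rfl | rfl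
    exacts [.inl hc, .inr hc]
  · rintro (ha | hb)
    exacts [⟨a, ha, h.inc_left⟩, ⟨b, hb, h.inc_right⟩]

theorem nonempty_iso_disjointUnion_of_cutSize_eq_zero {X : Set V(G)} (hX : G.cutSize X = 0) :
    Nonempty (Iso G (disjointUnion (G.induce (Subtype.val '' X))
      (G.induce (Subtype.val '' Xᶜ)))) := by
  have hcut : ∀ {e} {a b : V(G)}, G.IsLink e a b → (a ∈ X ↔ b ∈ X) := by
    intro e a b h
    by_contra hn
    have he := (h.mem_cutSet_iff X).2 hn
    rw [cutSize, Set.encard_eq_zero] at hX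
    simp [hX] at he
  set A : Set α := Subtype.val '' X with hA
  have hmem : ∀ a : V(G), (a : α) ∈ A ↔ a ∈ X := fun a ↦ by simp [hA]
  have hB : ∀ a, a ∈ (Subtype.val '' Xᶜ : Set α) ↔ a ∈ V(G) ∧ a ∉ A := fun a ↦ by
    constructor
    · rintro ⟨a, ha, rfl⟩
      exact ⟨a.2, by rwa [hmem]⟩
    · rintro ⟨ha, haA⟩
      exact ⟨⟨a, ha⟩, fun h ↦ haA ((hmem ⟨a, ha⟩).2 h), rfl⟩
  refine nonempty_iso_of_injective (sideMap_injective A)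
    (sideMap_injective {e | ∃ a ∈ A, G.Inc e a}) ?_ ?_
  · ext (a | b)
    · suffices a ∈ A ↔ ∃ c ∈ V(G), sideMap A c = .inl a by simpa [disjointUnion] using this
      constructor
      · exact fun ha ↦ ⟨a, by obtain ⟨a, -, rfl⟩ := ha; exact a.2, sideMap_of_mem ha⟩
      · rintro ⟨c, hc, h⟩
        by_cases hcA : c ∈ A <;> simp_all [sideMap]
    · suffices b ∈ (Subtype.val '' Xᶜ : Set α) ↔ ∃ c ∈ V(G), sideMap A c = .inr b by
        simpa [disjointUnion] using this
      rw [hB]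
      constructor
      · exact fun hb ↦ ⟨b, hb.1, sideMap_of_notMem hb.2⟩
      · rintro ⟨c, hc, h⟩
        by_cases hcA : c ∈ A <;> simp_all [sideMap]
  · intro e x y
    constructor
    · intro h
      change DisjointUnionLink _ _ e x y at h
      rcases h with ⟨h, ha, hb⟩ | ⟨h, ha, hb⟩
      · exact ⟨_, _, _, h, sideMap_of_mem ((exists_mem_inc_iff h).2 (.inl ha)),
          sideMap_of_mem ha, sideMap_of_mem hb⟩
      · rw [hB] at ha hb
        exact ⟨_, _, _, h, sideMap_of_notMem (by rw [exists_mem_inc_iff h]; tauto),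
          sideMap_of_notMem ha.2, sideMap_of_notMem hb.2⟩
    · rintro ⟨e, a, b, h, rfl, rfl, rfl⟩
      have hab := hcut (a := ⟨a, h.left_mem⟩) (b := ⟨b, h.right_mem⟩) h
      rw [← hmem, ← hmem] at hab
      by_cases ha : a ∈ A
      · rw [sideMap_of_mem ((exists_mem_inc_iff h).2 (.inl ha)), sideMap_of_mem ha,
          sideMap_of_mem (hab.1 ha)]
        exact DisjointUnionLink.left ⟨h, ha, hab.1 ha⟩
      · have hb := mt hab.2 ha
        rw [sideMap_of_notMem (by rw [exists_mem_inc_iff h]; tauto), sideMap_of_notMem ha,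
          sideMap_of_notMem hb]
        exact DisjointUnionLink.right ⟨h, (hB a).2 ⟨h.left_mem, ha⟩, (hB b).2 ⟨h.right_mem, hb⟩⟩

open Classical in
/-- Map all elements of `A` to `t`. -/
noncomputable def collapse (A : Set α) (t a : α) : α := if a ∈ A then t else a

theorem collapse_of_mem {A : Set α} {t a : α} (h : a ∈ A) : collapse A t a = t := if_pos h

theorem collapse_of_notMem {A : Set α} {t a : α} (h : a ∉ A) : collapse A t a = a := if_neg h

theorem mem_of_collapse_ne {A : Set α} {t a : α} (h : collapse A t a ≠ t) :
    a ∉ A ∧ collapse A t a = a := by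
  by_cases ha : a ∈ A
  · exact absurd (collapse_of_mem ha) h
  · exact ⟨ha, collapse_of_notMem ha⟩

theorem collapse_eq_iff {A : Set α} {t a : α} (ht : t ∈ A) : collapse A t a = t ↔ a ∈ A := by
  refine ⟨fun h ↦ ?_, collapse_of_mem⟩
  by_contra ha
  rw [collapse_of_notMem ha] at h
  exact ha (h ▸ ht)

theorem mem_vertexSet_contract_collapse {A : Set α} {t a : α} (hat : a ≠ t) :
    a ∈ V(G.contract (collapse A t)) ↔ a ∈ V(G) ∧ a ∉ A := by
  constructor
  · rintro ⟨a, ha, rfl⟩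
    have h := mem_of_collapse_ne hat
    rw [h.2]
    exact ⟨ha, h.1⟩
  · rintro ⟨ha, haA⟩
    exact ⟨a, ha, collapse_of_notMem haA⟩

theorem isLink_contract_collapse {A : Set α} {t : α} (hG : G.Loopless) {e : β}
    {a b : α} (ha : a ≠ t) (hb : b ≠ t) :
    (G.contract (collapse A t)).IsLink e a b ↔ G.IsLink e a b ∧ a ∉ A ∧ b ∉ A := by
  constructor
  · rintro ⟨-, a, b, h, rfl, rfl⟩
    have ha' := mem_of_collapse_ne ha
    have hb' := mem_of_collapse_ne hb
    rw [ha'.2, hb'.2]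
    exact ⟨h, ha'.1, hb'.1⟩
  · rintro ⟨h, ha, hb⟩
    exact ⟨h.ne, a, b, h, collapse_of_notMem ha, collapse_of_notMem hb⟩

theorem isLink_contract_collapse_left {A : Set α} {t : α} (ht : t ∈ A) {e : β} {b : α} :
    (G.contract (collapse A t)).IsLink e t b ↔ b ∉ A ∧ ∃ a ∈ A, G.IsLink e a b := by
  constructor
  · rintro ⟨hb, a, b, h, ha, rfl⟩
    have hb' := mem_of_collapse_ne hb.symm
    rw [hb'.2]
    exact ⟨hb'.1, a, (collapse_eq_iff ht).1 ha, h⟩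
  · rintro ⟨hb, a, ha, h⟩
    exact ⟨fun h ↦ hb (h ▸ ht), a, b, h, collapse_of_mem ha, collapse_of_notMem hb⟩

/-- Contraction keeps edge names, so contracting either side of a cut gives a vertex with the same
edge set. The bijection `σ` of the edge sum can therefore be the identity on names. -/
theorem incidenceSet_contract_collapse {X : Set V(G)} {A : Set α}
    (hA : ∀ a : V(G), (a : α) ∈ A ↔ a ∈ X) {t : α} (ht : t ∈ A) :
    (G.contract (collapse A t)).incidenceSet t = G.cutSet X := by
  ext e
  constructor
  · rintro ⟨b, h⟩
    obtain ⟨hb, a, ha, h⟩ := (isLink_contract_collapse_left ht).1 h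
    exact ⟨⟨a, h.left_mem⟩, ⟨b, h.right_mem⟩, h, (hA _).1 ha, fun hb' ↦ hb ((hA _).2 hb')⟩
  · rintro ⟨a, b, h, ha, hb⟩
    exact ⟨b, (isLink_contract_collapse_left ht).2
      ⟨fun hb' ↦ hb ((hA _).1 hb'), a, (hA _).2 ha, h⟩⟩

/-- A graph is an edge sum of the two graphs obtained by contracting the sides of a cut. -/
theorem isEdgeSum_contract_collapse (hG : G.Loopless) {X : Set V(G)} {s t : V(G)} (hs : s ∈ X)
    (ht : t ∉ X) {k : ℕ} (hk : G.cutSize X = k) :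
    IsEdgeSum k G (G.contract (collapse (Subtype.val '' X)ᶜ t))
      (G.contract (collapse (Subtype.val '' X) s)) := by
  set A : Set α := Subtype.val '' X with hA
  have hmem : ∀ a : V(G), (a : α) ∈ A ↔ a ∈ X := fun a ↦ by simp [hA]
  have hsA : (s : α) ∈ A := (hmem s).2 hs
  have htA : (t : α) ∈ Aᶜ := mt (hmem t).1 ht
  have h₁ := incidenceSet_contract_collapse (X := Xᶜ) (A := Aᶜ)
    (fun a ↦ not_congr (hmem a)) htA
  rw [cutSet_compl] at h₁
  have h₂ := incidenceSet_contract_collapse hmem hsA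
  refine ⟨t, ⟨t, t.2, collapse_of_mem htA⟩, s, ⟨s, s.2, collapse_of_mem hsA⟩,
    by rw [edgeDegree, h₁, ← hk, cutSize], by rw [edgeDegree, h₂, ← hk, cutSize],
    Equiv.setCongr (h₁.trans h₂.symm), ?_⟩
  have hne_t : ∀ {a}, a ∈ A → a ≠ (t : α) := fun ha h ↦ htA (h ▸ ha)
  have hne_s : ∀ {a}, a ∉ A → a ≠ (s : α) := fun ha h ↦ ha (h ▸ hsA)
  -- Edges with an end in `A` are named on the left, which includes the cut edges; this matches the
  -- naming of lifted edges in `edgeSum`.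
  refine nonempty_iso_of_injective (sideMap_injective A)
    (sideMap_injective {e | ∃ a ∈ A, G.Inc e a}) ?_ ?_
  · ext (a | b)
    · suffices (a ∈ V(G.contract (collapse Aᶜ t)) ∧ a ≠ t) ↔
          ∃ c ∈ V(G), sideMap A c = .inl a by simpa [edgeSum] using this
      constructor
      · rintro ⟨ha, hat⟩
        rw [mem_vertexSet_contract_collapse hat, Set.notMem_compl_iff] at ha
        exact ⟨a, ha.1, sideMap_of_mem ha.2⟩
      · rintro ⟨c, hc, h⟩
        by_cases hcA : c ∈ A
        · rw [sideMap_of_mem hcA, Sum.inl.injEq] at h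
          subst h
          refine ⟨?_, hne_t hcA⟩
          rw [mem_vertexSet_contract_collapse (hne_t hcA), Set.notMem_compl_iff]
          exact ⟨hc, hcA⟩
        · simp [sideMap_of_notMem hcA] at h
    · suffices (b ∈ V(G.contract (collapse A s)) ∧ b ≠ s) ↔
          ∃ c ∈ V(G), sideMap A c = .inr b by simpa [edgeSum] using this
      constructor
      · rintro ⟨hb, hbs⟩
        rw [mem_vertexSet_contract_collapse hbs] at hb
        exact ⟨b, hb.1, sideMap_of_notMem hb.2⟩
      · rintro ⟨c, hc, h⟩
        by_cases hcA : c ∈ A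
        · simp [sideMap_of_mem hcA] at h
        · rw [sideMap_of_notMem hcA, Sum.inr.injEq] at h
          subst h
          refine ⟨?_, hne_s hcA⟩
          rw [mem_vertexSet_contract_collapse (hne_s hcA)]
          exact ⟨hc, hcA⟩
  · have hlift : ∀ {e a b}, (G.contract (collapse Aᶜ t)).IsLink e t a →
        (G.contract (collapse A s)).IsLink e s b → G.IsLink e a b ∧ a ∈ A ∧ b ∉ A := by
      intro e a b ha hb
      obtain ⟨ha, c, hc, hca⟩ := (isLink_contract_collapse_left htA).1 ha
      obtain ⟨hb, d, hd, hdb⟩ := (isLink_contract_collapse_left hsA).1 hb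
      rw [Set.notMem_compl_iff] at ha
      refine ⟨?_, ha, hb⟩
      rcases hca.left_eq_or_eq hdb with rfl | rfl
      · exact absurd hd hc
      · exact hca.symm
    intro e x y
    constructor
    · intro h
      change EdgeSumLink _ _ _ _ _ e x y at h
      cases h with
      | left h ha hb =>
        rw [isLink_contract_collapse hG ha hb, Set.notMem_compl_iff,
          Set.notMem_compl_iff] at h
        exact ⟨_, _, _, h.1, sideMap_of_mem ((exists_mem_inc_iff h.1).2 (.inl h.2.1)),
          sideMap_of_mem h.2.1, sideMap_of_mem h.2.2⟩
      | right h ha hb =>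
        rw [isLink_contract_collapse hG ha hb] at h
        exact ⟨_, _, _, h.1, sideMap_of_notMem (by rw [exists_mem_inc_iff h.1]; tauto),
          sideMap_of_notMem h.2.1, sideMap_of_notMem h.2.2⟩
      | lift he ha hb _ _ =>
        obtain ⟨h, ha, hb⟩ := hlift ha hb
        exact ⟨_, _, _, h, sideMap_of_mem ((exists_mem_inc_iff h).2 (.inl ha)),
          sideMap_of_mem ha, sideMap_of_notMem hb⟩
      | lift' he ha hb _ _ =>
        obtain ⟨h, ha, hb⟩ := hlift ha hb
        exact ⟨_, _, _, h.symm, sideMap_of_mem ((exists_mem_inc_iff h).2 (.inl ha)),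
          sideMap_of_notMem hb, sideMap_of_mem ha⟩
    · rintro ⟨e, a, b, h, rfl, rfl, rfl⟩
      have key : ∀ {a b}, G.IsLink e a b → a ∈ A → b ∉ A →
          (G.contract (collapse Aᶜ t)).IsLink e t a ∧ (G.contract (collapse A s)).IsLink e s b := by
        intro a b h ha hb
        exact ⟨(isLink_contract_collapse_left htA).2 ⟨Set.notMem_compl_iff.2 ha, b, hb, h.symm⟩,
          (isLink_contract_collapse_left hsA).2 ⟨hb, a, ha, h⟩⟩
      by_cases ha : a ∈ A
      · rw [sideMap_of_mem ((exists_mem_inc_iff h).2 (.inl ha)), sideMap_of_mem ha]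
        by_cases hb : b ∈ A
        · rw [sideMap_of_mem hb]
          refine EdgeSumLink.left ?_ (hne_t ha) (hne_t hb)
          rw [isLink_contract_collapse hG (hne_t ha) (hne_t hb), Set.notMem_compl_iff,
            Set.notMem_compl_iff]
          exact ⟨h, ha, hb⟩
        · rw [sideMap_of_notMem hb]
          obtain ⟨h₁, h₂⟩ := key h ha hb
          exact EdgeSumLink.lift ⟨_, h₁⟩ h₁ h₂ (hne_t ha) (hne_s hb)
      · rw [sideMap_of_notMem ha]
        by_cases hb : b ∈ A
        · rw [sideMap_of_mem ((exists_mem_inc_iff h).2 (.inr hb)), sideMap_of_mem hb]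
          obtain ⟨h₁, h₂⟩ := key h.symm hb ha
          exact EdgeSumLink.lift' ⟨_, h₁⟩ h₁ h₂ (hne_t hb) (hne_s ha)
        · rw [sideMap_of_notMem hb, sideMap_of_notMem (by rw [exists_mem_inc_iff h]; tauto)]
          refine EdgeSumLink.right ?_ (hne_s ha) (hne_s hb)
          rw [isLink_contract_collapse hG (hne_s ha) (hne_s hb)]
          exact ⟨h, ha, hb⟩

end Contract

/-! ### From admissibility to the closure -/

section Decompose

variable {α : Type u} {β : Type v} {G : Graph α β}

/-- Only edges inside `A` become loops and disappear, so a vertex outside `A` keeps its cut. -/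
theorem edgeDegree_contract_collapse {A : Set α} {t a : α} (ha : a ∈ V(G)) (haA : a ∉ A)
    (ht : t ∈ A) : (G.contract (collapse A t)).edgeDegree a = G.cutSize {⟨a, ha⟩} := by
  have ha' : a ∈ V(G.contract (collapse A t)) := ⟨a, ha, collapse_of_notMem haA⟩
  have hl : (G.contract (collapse A t)).Loopless := ⟨fun _ _ h ↦ h.1 rfl⟩
  rw [edgeDegree_eq_cutSize hl ⟨a, ha'⟩, ← cutSize_preimage_contractMap]
  congr 1
  ext b
  simp only [Set.mem_preimage, Set.mem_singleton_iff, contractMap, Subtype.ext_iff]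
  constructor
  · intro h
    rw [← h]
    exact (mem_of_collapse_ne fun hb ↦ haA (h ▸ hb ▸ ht)).2.symm
  · intro h
    rw [h, collapse_of_notMem haA]

theorem vertexSet_contract_collapse_ssubset {A : Set α} {t t' : α} (ht : t ∈ V(G))
    (ht' : t' ∈ V(G)) (ht'A : t' ∈ A) (hne : t' ≠ t) :
    V(G.contract (collapse A t)) ⊂ V(G) := by
  refine Set.ssubset_iff_exists.2 ⟨?_, t', ht', fun h ↦ ?_⟩
  · rintro _ ⟨a, ha, rfl⟩
    by_cases haA : a ∈ A
    · rwa [collapse_of_mem haA]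
    · rwa [collapse_of_notMem haA]
  · exact ((mem_vertexSet_contract_collapse hne).1 h).2 ht'A

theorem IsAdmissibleRank.induce {ι : Type u₁} [LinearOrder ι] {r : V(G) → ι} {k : ℕ}
    (hr : IsAdmissibleRank G.cutSize k r) {W : Set α} (hW : W ⊆ V(G)) :
    IsAdmissibleRank (G.induce W).cutSize k (r ∘ Set.inclusion (t := V(G)) hW) := by
  refine ⟨hr.injective.comp (Set.inclusion_injective _), fun a ↦ ?_⟩
  obtain ⟨Y, haY, hY, hcY⟩ := hr.exists_cut (Set.inclusion hW a)
  refine ⟨Set.inclusion (t := V(G)) hW ⁻¹' Y, haY, fun b hb ↦ hY _ hb, le_trans (Set.encard_le_encard ?_) hcY⟩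
  rintro e ⟨b, c, h, hb, hc⟩
  exact ⟨_, _, h.1, hb, hc⟩

/-- A set that contains `s` and has the smallest cut among such subsets of itself can be contracted
to `s` without spoiling an admissible ranking. -/
theorem IsAdmissibleRank.contract_collapse {ι : Type u₁} [LinearOrder ι] {r : V(G) → ι} {k : ℕ}
    (hr : IsAdmissibleRank G.cutSize k r) {X : Set V(G)} {s : V(G)}
    (hs : s ∈ X) (hX : ∀ Z ⊆ X, s ∈ Z → G.cutSize X ≤ G.cutSize Z)
    (hV : V(G.contract (collapse (Subtype.val '' X) s)) ⊆ V(G)) (hXk : G.cutSize X ≤ k) :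
    IsAdmissibleRank (G.contract (collapse (Subtype.val '' X) s)).cutSize k
      (r ∘ Set.inclusion hV) := by
  set A : Set α := Subtype.val '' X with hA
  have hmem : ∀ a : V(G), (a : α) ∈ A ↔ a ∈ X := fun a ↦ by simp [hA]
  have htop : G.cutSize X ≠ ⊤ := ne_top_of_le_ne_top (ENat.natCast_ne_top k) hXk
  have hVX : ∀ a : V(G.contract (collapse A s)), Set.inclusion hV a ∈ X → (a : α) = s := by
    intro a ha
    by_contra hne
    exact ((mem_vertexSet_contract_collapse hne).1 a.2).2 ((hmem _).2 ha)
  refine ⟨hr.injective.comp (Set.inclusion_injective _), fun w ↦ ?_⟩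
  obtain ⟨Y, hwY, hY, hcY⟩ := hr.exists_cut (Set.inclusion hV w)
  -- A set that does not cross `X` is a preimage under the contraction, so its cut survives there.
  -- It must agree with `Y` on the remaining vertices, among which only `s` lies in `X`.
  suffices h : ∃ Z : Set V(G), (X ⊆ Z ∨ Disjoint X Z) ∧ G.cutSize Z ≤ G.cutSize Y ∧
      ∀ a : V(G.contract (collapse A s)), Set.inclusion hV a ∈ Z ↔ Set.inclusion hV a ∈ Y by
    obtain ⟨Z, hXZ, hcZ, hZ⟩ := h
    refine ⟨Set.inclusion hV ⁻¹' Z, (hZ w).2 hwY, fun a ha ↦ hY _ ((hZ a).1 ha), ?_⟩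
    rw [← cutSize_preimage_contractMap]
    refine le_trans (le_of_eq (congrArg G.cutSize ?_)) (hcZ.trans hcY)
    ext a
    by_cases ha : a ∈ X
    · have hcol : G.contractMap (collapse A s) a = ⟨s, s, s.2, collapse_of_mem ((hmem s).2 hs)⟩ :=
        Subtype.ext (collapse_of_mem ((hmem a).2 ha))
      rw [Set.mem_preimage, hcol]
      change s ∈ Z ↔ a ∈ Z
      rcases hXZ with h | h
      · exact iff_of_true (h hs) (h ha)
      · exact iff_of_false (Set.disjoint_left.1 h hs) (Set.disjoint_left.1 h ha)
    · have hcol : Set.inclusion hV (G.contractMap (collapse A s) a) = a :=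
        Subtype.ext (collapse_of_notMem (mt (hmem a).1 ha))
      rw [Set.mem_preimage, Set.mem_preimage, hcol]
  by_cases hsY : s ∈ Y
  -- Here `Y ∩ X` contains `s`, so its cut is no smaller than that of `X`, and submodularity gives
  -- the bound after cancelling the finite cut of `X`.
  · refine ⟨Y ∪ X, .inl Set.subset_union_right, ?_, fun a ↦ or_iff_left_of_imp fun ha ↦ ?_⟩
    · have h := (add_le_add le_rfl (hX (Y ∩ X) Set.inter_subset_right ⟨hsY, hs⟩)).trans
        (cutSize_union_add_cutSize_inter_le Y X)
      exact (ENat.add_le_add_iff_right htop).1 h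
    · rwa [show Set.inclusion hV a = s from Subtype.ext (hVX a ha)]
  -- Now `X \ Y` contains `s`, and posimodularity plays the same role.
  · refine ⟨Y \ X, .inr Set.disjoint_sdiff_right, ?_, fun a ↦ and_iff_left_of_imp fun ha hax ↦ ?_⟩
    · have h := (add_le_add le_rfl (hX (X \ Y) Set.sdiff_subset ⟨hs, hsY⟩)).trans
        (cutSize_sdiff_add_cutSize_sdiff_le Y X)
      exact (ENat.add_le_add_iff_right htop).1 h
    · apply hsY
      rwa [show Set.inclusion hV a = s from Subtype.ext (hVX a hax)] at ha

theorem edgeDegree_induce_le (W : Set α) (a : α) : (G.induce W).edgeDegree a ≤ G.edgeDegree a :=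
  Set.encard_le_encard fun _ ⟨b, h⟩ ↦ ⟨b, h.1⟩

theorem IsAdmissibleRank.edgeSumClosure {ι : Type u₁} [LinearOrder ι] {k : ℕ}
    (hG : G.IsFiniteLoopless) {r : V(G) → ι} (hr : IsAdmissibleRank G.cutSize k r) :
    EdgeSumClosure (AlmostBoundedEdgeDegree k) k G := by
  induction hn : V(G).ncard using Nat.strong_induction_on generalizing G with
  | _ n ih =>
  have hVfin := hG.finite_vertexSet
  have : Finite V(G) := hVfin
  set B : Set V(G) := {x | (k : ℕ∞) < G.cutSize {x}} with hB
  by_cases hBs : B.Subsingleton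
  · refine .base ⟨hG, fun x ⟨hx, hxk⟩ y ⟨hy, hyk⟩ ↦ ?_⟩
    rw [edgeDegree_eq_cutSize hG.loopless ⟨x, hx⟩] at hxk
    rw [edgeDegree_eq_cutSize hG.loopless ⟨y, hy⟩] at hyk
    exact congrArg Subtype.val (hBs hxk hyk)
  rw [Set.not_subsingleton_iff] at hBs
  -- Taking the last vertex of large degree makes `s` the only such vertex in any set that avoids
  -- everything before `s`.
  obtain ⟨s, hsB, hs⟩ := Set.exists_max_image B r B.toFinite hBs.nonempty
  obtain ⟨t, htB, hts⟩ := hBs.exists_ne s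
  have hrts : r t < r s := (hs t htB).lt_of_ne (hr.injective.ne hts)
  obtain ⟨X, ⟨hsX, hXr⟩, hX⟩ := Set.exists_min_image
    {X : Set V(G) | s ∈ X ∧ ∀ u ∈ X, r s ≤ r u} G.cutSize (Set.toFinite _)
    ⟨{s}, rfl, fun u hu ↦ by rw [Set.mem_singleton_iff.1 hu]⟩
  have hXk : G.cutSize X ≤ k := by
    obtain ⟨Y, hsY, hY, hcY⟩ := hr.exists_cut s
    exact (hX Y ⟨hsY, hY⟩).trans hcY
  have htX : t ∉ X := fun h ↦ (hXr t h).not_gt hrts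
  have hXB : ∀ x ∈ X, x ∈ B → x = s := fun x hx hxB ↦
    hr.injective ((hs x hxB).antisymm (hXr x hx))
  have hmem : ∀ a : V(G), (a : α) ∈ Subtype.val '' X ↔ a ∈ X := fun a ↦ by simp
  by_cases h0 : G.cutSize X = 0
  · have hsub : ∀ Z : Set V(G), (Subtype.val '' Z : Set α) ⊆ V(G) := fun Z ↦ by
      rintro _ ⟨a, -, rfl⟩
      exact a.2
    have h₁ : V(G.induce (Subtype.val '' X)) ⊂ V(G) :=
      Set.ssubset_iff_exists.2 ⟨hsub X, t, t.2, mt (hmem t).1 htX⟩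
    have h₂ : V(G.induce (Subtype.val '' Xᶜ)) ⊂ V(G) := by
      refine Set.ssubset_iff_exists.2 ⟨hsub Xᶜ, s, s.2, ?_⟩
      rintro ⟨a, ha, has⟩
      exact ha (Subtype.ext has ▸ hsX)
    refine .sum (.base ⟨hG.anti (induce_le (hsub X)), ?_⟩)
      (ih _ (hn ▸ Set.ncard_lt_ncard h₂ hVfin) (hG.anti (induce_le (hsub _)))
        (hr.induce (hsub _)) rfl)
      ((hVfin.subset h₁.subset).encard_lt_encard h₁) ((hVfin.subset h₂.subset).encard_lt_encard h₂)
      (.inl (nonempty_iso_disjointUnion_of_cutSize_eq_zero h0))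
    refine Set.subsingleton_of_forall_eq (s : α) ?_
    rintro _ ⟨⟨x, hx, rfl⟩, hxk⟩
    refine congrArg Subtype.val (hXB x hx ?_)
    rw [hB, Set.mem_ofPred_eq, ← edgeDegree_eq_cutSize hG.loopless]
    exact hxk.trans_le (edgeDegree_induce_le _ _)
  · obtain ⟨k', hk'⟩ := ENat.ne_top_iff_exists.1
      (ne_top_of_le_ne_top (ENat.natCast_ne_top k) hXk)
    -- Both sides have at least two vertices, since `{s}` and `{t}` have cuts larger than `k`. Hence
    -- both contractions have fewer vertices than `G`.
    obtain ⟨s', hs'X, hs's⟩ : ∃ s' ∈ X, s' ≠ s := by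
      by_contra! h
      rw [Set.eq_singleton_iff_unique_mem.2 ⟨hsX, h⟩] at hXk
      exact hXk.not_gt hsB
    obtain ⟨t', ht'X, ht't⟩ : ∃ t' ∈ Xᶜ, t' ≠ t := by
      by_contra! h
      rw [← cutSize_compl, Set.eq_singleton_iff_unique_mem.2 ⟨htX, h⟩] at hXk
      exact hXk.not_gt htB
    have h₁ : V(G.contract (collapse (Subtype.val '' X)ᶜ t)) ⊂ V(G) :=
      vertexSet_contract_collapse_ssubset t.2 t'.2 (mt (hmem t').1 ht'X)
        (Subtype.val_injective.ne ht't)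
    have h₂ : V(G.contract (collapse (Subtype.val '' X) s)) ⊂ V(G) :=
      vertexSet_contract_collapse_ssubset s.2 s'.2 ((hmem s').2 hs'X)
        (Subtype.val_injective.ne hs's)
    refine .sum (.base ⟨hG.contract _, ?_⟩)
      (ih _ (hn ▸ Set.ncard_lt_ncard h₂ hVfin) (hG.contract _)
        (hr.contract_collapse hsX (fun Z hZ hsZ ↦ hX Z ⟨hsZ, fun u hu ↦ hXr u (hZ hu)⟩)
          h₂.subset hXk) rfl)
      ((hVfin.subset h₁.subset).encard_lt_encard h₁) ((hVfin.subset h₂.subset).encard_lt_encard h₂)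
      (.inr ⟨k', ?_, ?_, isEdgeSum_contract_collapse hG.loopless hsX htX hk'.symm⟩)
    · refine Set.subsingleton_of_forall_eq (s : α) ?_
      rintro x ⟨hx, hxk⟩
      have htA : (t : α) ∈ (Subtype.val '' X)ᶜ := mt (hmem t).1 htX
      by_cases hxt : x = t
      -- The contracted vertex `t` has degree equal to the cut of `X`, hence at most `k`, although
      -- `t` had large degree in `G`.
      · have h := incidenceSet_contract_collapse (X := Xᶜ) (A := (Subtype.val '' X)ᶜ)
          (fun a ↦ not_congr (hmem a)) htA
        rw [hxt, edgeDegree, h, cutSet_compl] at hxk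
        exact absurd hxk hXk.not_gt
      · rw [mem_vertexSet_contract_collapse hxt, Set.notMem_compl_iff] at hx
        rw [edgeDegree_contract_collapse hx.1 (Set.notMem_compl_iff.2 hx.2) htA] at hxk
        exact congrArg Subtype.val (hXB ⟨x, hx.1⟩ ((hmem ⟨x, hx.1⟩).1 hx.2) hxk)
    · rw [Nat.one_le_iff_ne_zero]
      rintro rfl
      exact h0 hk'.symm
    · rw [← hk'] at hXk
      exact Nat.cast_le.1 hXk

end Decompose

end Graph

theorem mainTheorem1 {α : Type u} {β : Type v} (G : Graph α β)
    (hG : G.IsFiniteLoopless) :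
    (∀ k : ℕ, G.edgeAdmissibility ≤ (k : ℕ∞) →
      Graph.EdgeSumClosure (Graph.AlmostBoundedEdgeDegree k) k G) ∧
    (∀ k : ℕ, 1 ≤ k → Graph.EdgeSumClosure (Graph.AlmostBoundedEdgeDegree k) k G →
      G.edgeAdmissibility ≤ ((2 * k - 1 : ℕ) : ℕ∞)) := by
  constructor
  · intro k h
    obtain ⟨r, hr⟩ := Graph.exists_isAdmissibleRank_of_edgeAdmissibility_le h
    exact hr.edgeSumClosure hG
  · intro k hk h
    -- The bound `k` already holds, and `k ≤ 2 * k - 1` because `1 ≤ k`.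
    exact (h.edgeAdmissibility_le hG.finite_vertexSet).trans (Nat.cast_le.2 (by omega))
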